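/- Let $q$ be a power of an odd prime and let $P\in\mathbb F_q[X]$ be a fixed irreducible polynomial. Throughout, $d,g$ are non-negative integers and $Q$ runs over the monic irreducible polynomials of $\mathbb F_q[X]$. Let $\chi_P^+(F)=\chi_P(F)=\left(\frac FP\right)$ be the quadratic residue symbol ($0$ if $P\mid F$, $1$ if $F$ is a non-zero square modulo $P$, $-1$ otherwise) and let $\chi_P^-(F)=(-1)^{\deg F}\chi_P(F)$. Let $\mu^2$ be the indicator function of the square-free polynomials, and let $\eta_g=1$ if $g$ is even and $\eta_g=0$ if $g$ is odd. Put $$Z(u)=\sum_{F\text{ monic}}u^{\deg F}\ \ (|u|<q^{-1}),\qquad \zeta_q(s)=Z(q^{-s}),\qquad L(u,\chi_P^{\pm})=\sum_{d\ge 0}\Big(\sum_{F\text{ monic},\,\deg F=d}\chi_P^{\pm}(F)\Big)u^d,$$ $$H_{P,\pm}(u)=\prod_Q\left(1+u^{\deg Q}+2\chi_P^{\pm}(Q)u^{\deg Q}\right)\left(1-u^{\deg Q}\right)\left(1-\chi_P^{\pm}(Q)u^{\deg Q}\right)^2,$$ $$H_{P,0}(u)=\prod_Q\left(1+\big((-1)^{\deg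 Q}+\chi_P^+(Q)+\chi_P^-(Q)\big)u^{\deg Q}\right)\left(1-(-u)^{\deg Q}\right)\left(1-\chi_P^+(Q)u^{\deg Q}\right)\left(1-\chi_P^-(Q)u^{\deg Q}\right).$$ For non-negative integers $d_1,d_2,d_3$ let $L(d_1,d_2,d_3)=d_1+d_2+d_3$ if $d_1+d_3$ and $d_2+d_3$ are both even, and $L(d_1,d_2,d_3)=d_1+d_2+d_3+1$ otherwise. Let $\mathcal F_g$ be the set of triples $(f_1,f_2,f_3)$ of monic, square-free, pairwise coprime polynomials in $\mathbb F_q[X]$ such that $L(\deg f_1,\deg f_2,\deg f_3)=g+3$ and the multiset $\{\deg f_1,\deg f_2,\deg f_3\}$ is neither $\{g+3,0,0\}$ nor $\{g+2,0,0\}$. For $k_1,k_2\in\{0,1\}$ let $$N_{k_1,k_2}(d;P)=\sum_{\substack{f_1,f_2,f_3\text{ monic},\ \deg(f_1f_2f_3)=d\\ \deg(f_1f_3)\equiv k_1,\ \deg(f_2f_3)\equiv k_2\ (\mathrm{mod}\ 2)}}\mu^2(f_1f_2f_3)\,\chi_P(f_1f_2).$$ Then the following hold. 1. The coefficient of $u^d$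 in $L(u,\chi_P^{\pm})$ vanishes for all $d\ge\deg P$, so that $L(u,\chi_P^\pm)$ is a polynomial in $u$; and the products $H_{P,+}(u)$, $H_{P,-}(u)$, $H_{P,0}(u)$ converge for all complex $u$ with $|u|<q^{-1/2}$. 2. For all $k_1,k_2\in\{0,1\}$ and every $\epsilon>0$, $$N_{k_1,k_2}(d;P)=\frac{C_{k_1,k_2}(d;P)}4\,q^d+O\!\left(q^{(\frac12+\epsilon)d}\right)\qquad(d\ge 0),$$ where $$C_{k_1,k_2}(d;P)=L(q^{-1},\chi_P^+)^2H_{P,+}(q^{-1})+(-1)^{k_1+k_2}L(q^{-1},\chi_P^-)^2H_{P,-}(q^{-1})+(-1)^d\big((-1)^{k_1}+(-1)^{k_2}\big)L(q^{-1},\chi_P^+)L(q^{-1},\chi_P^-)H_{P,0}(q^{-1}).$$ 3. For every $\epsilon>0$, $$\sum_{(f_1,f_2,f_3)\in\mathcal F_g}\chi_P(f_1f_2)=\frac{C(g;P)}4\,q^{g+3}-(1-\eta_g)\left(2\sum_{\substack{f\text{ monic}\\ \deg f\in\{g+2,g+3\}}}\mu^2(f)\chi_P(f)+\frac{q+1}{q}\,\frac{q^{g+3}}{\zeta_q(2)}\right)+O\!\left(q^{(\frac12+\epsilon)g}\right)\qquad(g\ge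 0),$$ where $$C(g;P)=\frac{q+3}{q}L(q^{-1},\chi_P^+)^2H_{P,+}(q^{-1})+\frac{q-1}{q}L(q^{-1},\chi_P^-)^2H_{P,-}(q^{-1})-2(-1)^g\,\frac{q+1}{q}L(q^{-1},\chi_P^+)L(q^{-1},\chi_P^-)H_{P,0}(q^{-1}).$$ The implied constants depend only on $q$, $P$ and $\epsilon$ (and, in 2, on $k_1,k_2$). -/

import Mathlib

open Polynomial

namespace Biquad

variable (K : Type*) [Field K] [Fintype K]

theorem finite_natDegree_le (n : ℕ) : {f : K[X] | f.natDegree ≤ n}.Finite := by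
  have hfin : Finite (degreeLT K (n + 1)) :=
    Finite.of_equiv _ (degreeLTEquiv K (n + 1)).toEquiv.symm
  refine Set.Finite.subset (s := ((degreeLT K (n + 1) : Submodule K K[X]) : Set K[X]))
    (Set.toFinite _) ?_
  intro f hf
  have hf' : f.natDegree ≤ n := hf
  simp only [SetLike.mem_coe, mem_degreeLT]
  exact lt_of_le_of_lt degree_le_natDegree (by exact_mod_cast Nat.lt_succ_of_le hf')

theorem finite_triples (n : ℕ) (S : Set (K[X] × K[X] × K[X]))
    (hS : ∀ t ∈ S, t.1.natDegree + t.2.1.natDegree + t.2.2.natDegree ≤ n) : S.Finite := by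
  have h := finite_natDegree_le K n
  refine (h.prod (h.prod h)).subset ?_
  rintro ⟨a, b, c⟩ ht
  have := hS _ ht
  simp only [Set.mem_prod, Set.mem_ofPred_eq] at this ⊢
  omega

theorem finite_monic_natDegree (d : ℕ) : {f : K[X] | f.Monic ∧ f.natDegree = d}.Finite :=
  (finite_natDegree_le K d).subset fun _ hf => hf.2.le

/-- The finite set of monic polynomials of degree `d` over `K`. -/
noncomputable def monics (d : ℕ) : Finset K[X] := (finite_monic_natDegree K d).toFinset

theorem mem_monics {d : ℕ} {f : K[X]} : f ∈ monics K d ↔ f.Monic ∧ f.natDegree = d := by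
  simp [monics]

/-- The monic prime (irreducible) polynomials over `K`. -/
abbrev MonicPrime : Type _ := {Q : K[X] // Q.Monic ∧ Irreducible Q}

variable {K}

open Classical in
/-- The quadratic residue symbol `χ_P(F) = (F / P)`: `0` if `P ∣ F`, `1` if `F` is a non-zero
square modulo `P`, and `-1` otherwise. -/
noncomputable def chi (P F : K[X]) : ℂ :=
  ((quadraticCharFun (AdjoinRoot P) (AdjoinRoot.mk P F) : ℤ) : ℂ)

/-- The twist `χ_P^-(F) = (-1)^{deg F} χ_P(F)`. -/
noncomputable def chiMinus (P F : K[X]) : ℂ := (-1) ^ F.natDegree * chi P F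

open Classical in
/-- `μ²`, the indicator function of the square-free polynomials. -/
noncomputable def muSq (F : K[X]) : ℂ := if Squarefree F then 1 else 0

/-- The series `∑_F a(F) u^{deg F}` over monic `F`, arranged as a power series in `u`. -/
noncomputable def genSeries (a : K[X] → ℂ) (u : ℂ) : ℂ :=
  ∑' d : ℕ, (∑ F ∈ monics K d, a F) * u ^ d

/-- The `L`-function `L(u, χ)`. For `χ = χ_P^±` the coefficients of degree at least `deg P` vanish,
so that this is the polynomial which continues the Dirichlet series to all `u`. -/
noncomputable def LFun (χ : K[X] → ℂ) (u : ℂ) : ℂ := genSeries χ u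

variable (K) in
/-- The zeta function `Z(u)` of the affine line over `K`, for `|u| < 1/q`. -/
noncomputable def Z (u : ℂ) : ℂ := genSeries (fun _ : K[X] => 1) u

variable (K) in
/-- `ζ_q(s) = Z(q^{-s})`. -/
noncomputable def zetaQ (s : ℂ) : ℂ := Z K ((Fintype.card K : ℂ) ^ (-s))

/-- The local factor at `Q` of `H_{P,±}(u)`, with `χ = χ_P^±`. It is the quotient of the local
factor of `∏_Q (1 + u^{deg Q} + 2 χ(Q) u^{deg Q})` by that of `Z(u) L(u, χ)²`. -/
noncomputable def HpmFactor (χ : K[X] → ℂ) (u : ℂ) (Q : MonicPrime K) : ℂ :=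
  (1 + u ^ Q.1.natDegree + 2 * χ Q.1 * u ^ Q.1.natDegree) *
    (1 - u ^ Q.1.natDegree) * (1 - χ Q.1 * u ^ Q.1.natDegree) ^ 2

/-- `H_{P,±}(u)`, with `χ = χ_P^±`. -/
noncomputable def Hpm (χ : K[X] → ℂ) (u : ℂ) : ℂ := ∏' Q : MonicPrime K, HpmFactor χ u Q

/-- The local factor at `Q` of `H_{P,0}(u)`. It is the quotient of the local factor of
`∏_Q (1 + ((-1)^{deg Q} + χ_P^+(Q) + χ_P^-(Q)) u^{deg Q})` by that of
`Z(-u) L(u, χ_P^+) L(u, χ_P^-)`. -/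
noncomputable def HzeroFactor (P : K[X]) (u : ℂ) (Q : MonicPrime K) : ℂ :=
  (1 + ((-1) ^ Q.1.natDegree + chi P Q.1 + chiMinus P Q.1) * u ^ Q.1.natDegree) *
    (1 - (-u) ^ Q.1.natDegree) *
    (1 - chi P Q.1 * u ^ Q.1.natDegree) * (1 - chiMinus P Q.1 * u ^ Q.1.natDegree)

/-- `H_{P,0}(u)`. -/
noncomputable def Hzero (P : K[X]) (u : ℂ) : ℂ := ∏' Q : MonicPrime K, HzeroFactor P u Q

/-- The numerical function `L(d₁, d₂, d₃)` of the genus formula `g + 3 = L(d₁, d₂, d₃)`. -/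
def genusL (d₁ d₂ d₃ : ℕ) : ℕ :=
  d₁ + d₂ + d₃ + if (d₁ + d₃) % 2 = 0 ∧ (d₂ + d₃) % 2 = 0 then 0 else 1

variable (K) in
/-- The set `F̂_g` of triples parametrizing the biquadratic curves of genus `g`. -/
def FgHat (g : ℕ) : Set (K[X] × K[X] × K[X]) :=
  {t | Squarefree t.1 ∧ Squarefree t.2.1 ∧ Squarefree t.2.2 ∧
    IsCoprime t.1 t.2.1 ∧ IsCoprime t.1 t.2.2 ∧ IsCoprime t.2.1 t.2.2 ∧
    t.2.2.Monic ∧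
    genusL t.1.natDegree t.2.1.natDegree t.2.2.natDegree = g + 3 ∧
    ({t.1.natDegree, t.2.1.natDegree, t.2.2.natDegree} : Multiset ℕ) ≠ {g + 3, 0, 0} ∧
    ({t.1.natDegree, t.2.1.natDegree, t.2.2.natDegree} : Multiset ℕ) ≠ {g + 2, 0, 0}}

variable (K) in
/-- The set `F_g` of the triples of monic polynomials in `F̂_g`. -/
def Fg (g : ℕ) : Set (K[X] × K[X] × K[X]) :=
  {t | t ∈ FgHat K g ∧ t.1.Monic ∧ t.2.1.Monic ∧ t.2.2.Monic}

variable (K) in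
theorem Fg_finite (g : ℕ) : (Fg K g).Finite := by
  refine finite_triples K (g + 3) _ ?_
  rintro t ⟨⟨-, -, -, -, -, -, -, h, -⟩, -⟩
  rw [← h, genusL]
  omega

variable (K) in
/-- The triples of monic polynomials over which `N_{k₁,k₂}(d;P)` is summed. -/
def parityTriples (k₁ k₂ d : ℕ) : Set (K[X] × K[X] × K[X]) :=
  {t | t.1.Monic ∧ t.2.1.Monic ∧ t.2.2.Monic ∧
    (t.1 * t.2.1 * t.2.2).natDegree = d ∧
    (t.1 * t.2.2).natDegree ≡ k₁ [MOD 2] ∧ (t.2.1 * t.2.2).natDegree ≡ k₂ [MOD 2]}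

variable (K) in
theorem parityTriples_finite (k₁ k₂ d : ℕ) : (parityTriples K k₁ k₂ d).Finite := by
  refine finite_triples K d _ ?_
  rintro t ⟨h1, h2, h3, h, -⟩
  rw [(h1.mul h2).natDegree_mul h3, h1.natDegree_mul h2] at h
  exact h.le

/-- `N_{k₁,k₂}(d;P) = ∑ μ²(f₁f₂f₃) χ_P(f₁f₂)`. -/
noncomputable def N (P : K[X]) (k₁ k₂ d : ℕ) : ℂ :=
  ∑ t ∈ (parityTriples_finite K k₁ k₂ d).toFinset,
    muSq (t.1 * t.2.1 * t.2.2) * chi P (t.1 * t.2.1)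

/-- `∑_{(f₁,f₂,f₃) ∈ F_g} χ_P(f₁f₂)`. -/
noncomputable def sumFg (P : K[X]) (g : ℕ) : ℂ :=
  ∑ t ∈ (Fg_finite K g).toFinset, chi P (t.1 * t.2.1)

/-- The constant `C_{k₁,k₂}(d;P)`. -/
noncomputable def Ck (P : K[X]) (k₁ k₂ d : ℕ) : ℂ :=
  let v : ℂ := (Fintype.card K : ℂ)⁻¹
  LFun (chi P) v ^ 2 * Hpm (chi P) v +
    (-1) ^ (k₁ + k₂) * LFun (chiMinus P) v ^ 2 * Hpm (chiMinus P) v +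
    (-1) ^ d * ((-1) ^ k₁ + (-1) ^ k₂) * LFun (chi P) v * LFun (chiMinus P) v * Hzero P v

/-- The constant `C(g;P)`. -/
noncomputable def C (P : K[X]) (g : ℕ) : ℂ :=
  let q : ℂ := Fintype.card K
  (q + 3) / q * LFun (chi P) q⁻¹ ^ 2 * Hpm (chi P) q⁻¹ +
    (q - 1) / q * LFun (chiMinus P) q⁻¹ ^ 2 * Hpm (chiMinus P) q⁻¹ -
    2 * (-1) ^ g * ((q + 1) / q) * LFun (chi P) q⁻¹ * LFun (chiMinus P) q⁻¹ * Hzero P q⁻¹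

/-- `η_n = 1` for even `n` and `η_n = 0` for odd `n`. -/
def eta (n : ℕ) : ℂ := if Even n then 1 else 0

/-- The sum `∑_{deg f = d} μ²(f) χ_P(f)` over monic `f`. -/
noncomputable def sqfreeCharSum (P : K[X]) (d : ℕ) : ℂ := ∑ f ∈ monics K d, muSq f * chi P f

end Biquad

/-!
A square-free `F` has one factorization `F = f₁f₂f₃` for each way of distributing its primes, so for
multiplicative `ψ₁, ψ₂` the generating series of `∑ ψ₁(f₁) ψ₂(f₂)` over square-free products is
`∏_Q (1 + (ψ₁(Q) + ψ₂(Q) + 1) u^{deg Q})`. Dividing by `Z(u) L(u, ψ₁) L(u, ψ₂)` leaves a product of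
factors `1 + O(|u|^{2 deg Q})`, holomorphic in `|u| < q^{-1/2}`. When the two `L`-functions are
polynomials the series therefore has there only the simple pole of `Z(u) = (1 - q u)⁻¹`; subtracting
it and applying Cauchy's estimate on a circle of radius just below `q^{-1/2}` gives the main term
and the error. For `χ_P^±`, the vanishing of the high coefficients of `L` is orthogonality: once
`deg F ≥ deg P`, the residues of monic `F` modulo `P` are equidistributed.

The parity conditions in `N_{k₁,k₂}` are detected by `(1 + (-1)^n) / 2`. Since
`(-1)^d = (-1)^{deg f₁ + deg f₂ + deg f₃}`, the resulting signs combine into `χ_P^±(f₁) χ_P^±(f₂)`,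
and the mixed terms, whose pole is at `-1/q` in the natural variable, become
`(-1)^d χ_P^+(f₁) χ_P^-(f₂)` with a pole at `1/q`. Finally `F_g` consists of the triples of total
degree `g + 3` with both parities even and those of total degree `g + 2` with some parity odd, minus
the triples `(F, 1, 1)`, `(1, F, 1)`, `(1, 1, F)`; these meet the two parts only when `g` is odd.
-/

namespace Biquad

open Filter Topology Asymptotics

section EulerProduct

variable {K : Type*} [Field K]

theorem MonicPrime.prime (Q : MonicPrime K) : Prime Q.1 := Q.2.2.prime

theorem MonicPrime.eq_of_dvd {Q R : MonicPrime K} (h : Q.1 ∣ R.1) : Q = R :=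
  Subtype.ext (eq_of_monic_of_associated Q.2.1 R.2.1 (Q.2.2.associated_of_dvd R.2.2 h))

theorem MonicPrime.not_dvd_one (Q : MonicPrime K) : ¬ Q.1 ∣ 1 :=
  fun h => Q.2.2.not_isUnit (isUnit_of_dvd_one h)

theorem exists_monicPrime_dvd {F : K[X]} (hF : F.Monic) (h1 : F ≠ 1) :
    ∃ Q : MonicPrime K, Q.1 ∣ F := by
  obtain ⟨R, hR, hm, hd⟩ := exists_monic_irreducible_factor F fun h => h1 (hF.eq_one_of_isUnit h)
  exact ⟨⟨R, hR, hm⟩, hd⟩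

variable (K) in
/-- The multiplicative monoid of monic polynomials, the index set of Dirichlet series over
`K[X]`. -/
def monicSubmonoid : Submonoid K[X] where
  carrier := {F | F.Monic}
  one_mem' := monic_one
  mul_mem' := Monic.mul

/-- A monic prime as an element of the monoid of monic polynomials. -/
def MonicPrime.toMonic (Q : MonicPrime K) : monicSubmonoid K := ⟨Q.1, Q.2.1⟩

theorem MonicPrime.toMonic_injective :
    Function.Injective (MonicPrime.toMonic : MonicPrime K → monicSubmonoid K) :=
  fun _ _ h => Subtype.ext (congrArg (fun F : monicSubmonoid K => F.1) h)

/-- The monic polynomials which survive sieving by the primes in `S`. -/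
def sifted (S : Finset (MonicPrime K)) : Set (monicSubmonoid K) :=
  {F | ∀ Q ∈ S, ¬ Q.1 ∣ F.1}

theorem one_mem_sifted (S : Finset (MonicPrime K)) : 1 ∈ sifted S :=
  fun Q _ => Q.not_dvd_one

theorem eventually_notMem_sifted {F : monicSubmonoid K} (hF : F ≠ 1) :
    ∀ᶠ S in atTop, F ∉ sifted S := by
  obtain ⟨Q, hQ⟩ := exists_monicPrime_dvd F.2 fun h => hF (Subtype.ext h)
  filter_upwards [eventually_ge_atTop {Q}] with S hS hFS
  exact hFS Q (by simpa using hS) hQ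

theorem mul_mem_sifted {S : Finset (MonicPrime K)} {R : MonicPrime K} (hR : R ∉ S)
    {F : monicSubmonoid K} (hF : F ∈ sifted S) : R.toMonic * F ∈ sifted S := by
  intro Q hQ h
  rcases Q.prime.dvd_or_dvd h with h | h
  · exact hR (MonicPrime.eq_of_dvd h ▸ hQ)
  · exact hF Q hQ h

open Classical in
theorem sifted_eq_image_union {S : Finset (MonicPrime K)} {R : MonicPrime K} (hR : R ∉ S) :
    sifted S = (R.toMonic * ·) '' sifted S ∪ sifted (insert R S) := by
  ext F
  constructor
  · intro hF
    by_cases hRF : R.1 ∣ F.1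
    · obtain ⟨G, hG⟩ := hRF
      refine .inl ⟨⟨G, R.2.1.of_mul_monic_left (hG ▸ F.2)⟩, fun Q hQ h => hF Q hQ ?_,
        Subtype.ext hG.symm⟩
      exact hG ▸ h.mul_left _
    · exact .inr (Finset.forall_mem_insert _ _ _ |>.2 ⟨hRF, hF⟩)
  · rintro (⟨G, hG, rfl⟩ | hF)
    · exact mul_mem_sifted hR hG
    · exact fun Q hQ => hF Q (Finset.mem_insert_of_mem hQ)

open Classical in
theorem disjoint_image_sifted (S : Finset (MonicPrime K)) (R : MonicPrime K) :
    Disjoint ((R.toMonic * ·) '' sifted S) (sifted (insert R S)) := by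
  refine Set.disjoint_left.2 ?_
  rintro _ ⟨G, -, rfl⟩ h
  exact h R (Finset.mem_insert_self R S) (dvd_mul_right _ _)

variable {A : Type*} [NormedCommRing A] [CompleteSpace A] {w : monicSubmonoid K →* A}

theorem tsum_sifted (hw : Summable w) (S : Finset (MonicPrime K)) :
    ∑' F : sifted S, w F = (∑' F, w F) * ∏ Q ∈ S, (1 - w Q.toMonic) := by
  classical
  induction S using Finset.induction_on with
  | empty =>
    have : sifted (∅ : Finset (MonicPrime K)) = Set.univ := by simp [sifted]
    rw [this, tsum_univ, Finset.prod_empty, mul_one]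
  | insert R S hR ih =>
    have hmul : ∑' F : (R.toMonic * ·) '' sifted S, w F = w R.toMonic * ∑' F : sifted S, w F := by
      have hinj : Set.InjOn (R.toMonic * ·) (sifted S) := fun G _ H _ h =>
        Subtype.ext (mul_left_cancel₀ R.2.1.ne_zero (congrArg Subtype.val h))
      rw [tsum_image w hinj]
      simp_rw [map_mul]
      exact (hw.subtype _).tsum_mul_left _
    have hsplit := hw.subtype _ |>.tsum_union_disjoint (disjoint_image_sifted S R) (hw.subtype _)
    rw [← sifted_eq_image_union hR, hmul] at hsplit
    rw [Finset.prod_insert hR, mul_left_comm, ← ih, one_sub_mul, eq_sub_iff_add_eq', ← hsplit]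

theorem tendsto_tsum_sifted (hw : Summable fun F => ‖w F‖) :
    Tendsto (fun S : Finset (MonicPrime K) => ∑' F : sifted S, w F) atTop (𝓝 1) := by
  simp_rw [tsum_subtype]
  have hone : ∑' F, ({1} : Set (monicSubmonoid K)).indicator w F = 1 := by
    rw [← tsum_subtype, tsum_singleton, map_one]
  rw [← hone]
  refine tendsto_tsum_of_dominated_convergence hw (fun F => ?_)
    (.of_forall fun S F => norm_indicator_le_norm_self w F)
  refine tendsto_const_nhds.congr' ?_
  by_cases hF : F = 1
  · subst hF
    exact .of_forall fun S => (Set.indicator_of_mem (Set.mem_singleton 1) w).trans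
      (Set.indicator_of_mem (one_mem_sifted S) w).symm
  · filter_upwards [eventually_notMem_sifted hF] with S hS
    rw [Set.indicator_of_notMem (s := {1}) hF, Set.indicator_of_notMem hS]

theorem tsum_mul_tprod_one_sub [NormOneClass A] (hw : Summable fun F => ‖w F‖) :
    (∑' F, w F) * ∏' Q : MonicPrime K, (1 - w Q.toMonic) = 1 := by
  have hprimes : Summable fun Q : MonicPrime K => ‖-w Q.toMonic‖ := by
    simpa only [norm_neg, Function.comp_def] using
      hw.comp_injective MonicPrime.toMonic_injective
  have hprod := (multipliable_one_add_of_summable hprimes).hasProd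
  simp only [← sub_eq_add_neg] at hprod
  refine tendsto_nhds_unique (hprod.const_mul _) ?_
  simpa only [SummationFilter.unconditional_filter, tsum_sifted hw.of_norm] using
    tendsto_tsum_sifted hw

end EulerProduct

section Fibers

variable {β γ : Type*} {g : β → γ} {S : γ → Finset β}

theorem tsum_fiber {A : Type*} [AddCommMonoid A] [TopologicalSpace A]
    (hS : ∀ c b, b ∈ S c ↔ g b = c) (f : β → A) (c : γ) :
    ∑' b : g ⁻¹' {c}, f b = ∑ b ∈ S c, f b := by
  have : g ⁻¹' {c} = (S c : Set β) := by
    ext b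
    simp [hS]
  rw [this, Finset.tsum_subtype']

theorem hasSum_sum_fiber {A : Type*} [AddCommGroup A] [UniformSpace A] [IsUniformAddGroup A]
    [CompleteSpace A] [T2Space A] (hS : ∀ c b, b ∈ S c ↔ g b = c) {f : β → A} {a : A}
    (hf : HasSum f a) : HasSum (fun c => ∑ b ∈ S c, f b) a := by
  simpa only [tsum_fiber hS] using hf.tsum_fiberwise g

theorem summable_of_summable_sum_fiber (hS : ∀ c b, b ∈ S c ↔ g b = c) {f : β → ℝ}
    (hf : ∀ b, 0 ≤ f b) (h : Summable fun c => ∑ b ∈ S c, f b) : Summable f := by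
  rw [← (Equiv.sigmaFiberEquiv g).summable_iff]
  refine (summable_sigma_of_nonneg fun x => hf _).2 ?_
  have hfin (c : γ) : Finite {b // g b = c} :=
    ((S c).finite_toSet.subset fun b hb => (hS c b).2 hb).to_subtype
  exact ⟨fun c => have := hfin c; .of_finite, h.congr fun c => (tsum_fiber hS f c).symm⟩

end Fibers

section MonicSeries

variable {K : Type*} [Field K] [Fintype K]

open Classical in
theorem mem_subtype_monics (d : ℕ) (F : monicSubmonoid K) :
    F ∈ (monics K d).subtype (· ∈ monicSubmonoid K) ↔ F.1.natDegree = d := by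
  rw [Finset.mem_subtype, mem_monics]
  exact and_iff_right F.2

open Classical in
theorem sum_subtype_monics {A : Type*} [AddCommMonoid A] (d : ℕ) (f : K[X] → A) :
    ∑ F ∈ (monics K d).subtype (· ∈ monicSubmonoid K), f F = ∑ F ∈ monics K d, f F :=
  Finset.sum_subtype_of_mem f fun _ hF => ((mem_monics K).1 hF).1

theorem card_monics (d : ℕ) : (monics K d).card = Fintype.card K ^ d := by
  have e : {F // F ∈ monics K d} ≃ (Fin d → K) :=
    (Equiv.subtypeEquivRight fun F => mem_monics K).trans
      ((monicEquivDegreeLT d).trans (degreeLTEquiv K d).toEquiv)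
  simpa using Fintype.card_congr e

theorem sum_monics_mul_pow {A : Type*} [CommSemiring A] (a : K[X] → A) (u : A) (d : ℕ) :
    ∑ F ∈ monics K d, a F * u ^ F.natDegree = (∑ F ∈ monics K d, a F) * u ^ d := by
  rw [Finset.sum_mul]
  exact Finset.sum_congr rfl fun F hF => by rw [((mem_monics K).1 hF).2]

theorem summable_pow_natDegree {ρ : ℝ} (h0 : 0 ≤ ρ) (h1 : Fintype.card K * ρ < 1) :
    Summable fun F : monicSubmonoid K => ρ ^ F.1.natDegree := by
  classical
  refine summable_of_summable_sum_fiber mem_subtype_monics (fun F => pow_nonneg h0 _) ?_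
  refine (summable_geometric_of_lt_one (by positivity) h1).congr fun d => ?_
  have h := sum_monics_mul_pow (fun _ : K[X] => 1) ρ d
  simp only [one_mul, Finset.sum_const, card_monics, nsmul_eq_mul, mul_one, Nat.cast_pow] at h
  rw [sum_subtype_monics d fun F => ρ ^ F.natDegree, h, mul_pow]

theorem summable_prime_pow_natDegree {ρ : ℝ} (h0 : 0 ≤ ρ) (h1 : Fintype.card K * ρ < 1) :
    Summable fun Q : MonicPrime K => ρ ^ Q.1.natDegree := by
  have h := (summable_pow_natDegree h0 h1).comp_injective MonicPrime.toMonic_injective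
  exact h

theorem summable_norm_prime {a : MonicPrime K → ℂ} {c : ℝ} (ha : ∀ Q, ‖a Q‖ ≤ c) {u : ℂ}
    (hu : Fintype.card K * ‖u‖ < 1) :
    Summable fun Q : MonicPrime K => ‖a Q * u ^ Q.1.natDegree‖ := by
  refine .of_nonneg_of_le (fun _ => norm_nonneg _) (fun Q => ?_)
    ((summable_prime_pow_natDegree (norm_nonneg u) hu).mul_left c)
  rw [norm_mul, norm_pow]
  exact mul_le_mul_of_nonneg_right (ha Q) (by positivity)

variable {u : ℂ} {a : K[X] → ℂ} {c : ℝ}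

theorem summable_norm_mul_pow (ha : ∀ F, ‖a F‖ ≤ c) (hu : Fintype.card K * ‖u‖ < 1) :
    Summable fun F : monicSubmonoid K => ‖a F * u ^ F.1.natDegree‖ := by
  refine .of_nonneg_of_le (fun _ => norm_nonneg _) (fun F => ?_)
    ((summable_pow_natDegree (norm_nonneg u) hu).mul_left c)
  rw [norm_mul, norm_pow]
  exact mul_le_mul_of_nonneg_right (ha F) (by positivity)

theorem hasSum_genSeries (ha : ∀ F, ‖a F‖ ≤ c) (hu : Fintype.card K * ‖u‖ < 1) :
    HasSum (fun d => (∑ F ∈ monics K d, a F) * u ^ d)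
      (∑' F : monicSubmonoid K, a F * u ^ F.1.natDegree) := by
  classical
  simpa only [sum_subtype_monics _ fun F => a F * u ^ F.natDegree, sum_monics_mul_pow] using
    hasSum_sum_fiber mem_subtype_monics (summable_norm_mul_pow ha hu).of_norm.hasSum

/-- The completely multiplicative function `F ↦ ψ(F) u^{deg F}` on monic polynomials. -/
noncomputable def degreeWeight (ψ : K[X] →* ℂ) (u : ℂ) : monicSubmonoid K →* ℂ where
  toFun F := ψ F * u ^ F.1.natDegree
  map_one' := by simp
  map_mul' F G := by
    rw [Submonoid.coe_mul, map_mul, Monic.natDegree_mul F.2 G.2, pow_add]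
    ring

theorem genSeries_mul_tprod_one_sub {ψ : K[X] →* ℂ} (hψ : ∀ F, ‖ψ F‖ ≤ c)
    (hu : Fintype.card K * ‖u‖ < 1) :
    genSeries ψ u * ∏' Q : MonicPrime K, (1 - ψ Q.1 * u ^ Q.1.natDegree) = 1 := by
  rw [genSeries, (hasSum_genSeries hψ hu).tsum_eq]
  exact tsum_mul_tprod_one_sub (w := degreeWeight ψ u) (summable_norm_mul_pow hψ hu)

theorem Z_eq (hu : Fintype.card K * ‖u‖ < 1) : Z K u = (1 - Fintype.card K * u)⁻¹ := by
  have h : ‖(Fintype.card K : ℂ) * u‖ < 1 := by simpa using hu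
  rw [← tsum_geometric_of_norm_lt_one h]
  simp [Z, genSeries, card_monics, mul_pow]

end MonicSeries

section PrimeDivisors

variable {K : Type*} [Field K]

open UniqueFactorizationMonoid in
open Classical in
/-- The set of monic primes dividing a non-zero polynomial. On square-free monic polynomials it
is inverse to the product of a finite set of primes. -/
noncomputable def primeDivisors (F : K[X]) : Finset (MonicPrime K) :=
  (primeFactors F).subtype _

theorem mem_primeDivisors {F : K[X]} (hF : F ≠ 0) {Q : MonicPrime K} :
    Q ∈ primeDivisors F ↔ Q.1 ∣ F := by
  classical
  rw [primeDivisors, Finset.mem_subtype, UniqueFactorizationMonoid.mem_primeFactors,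
    Polynomial.mem_normalizedFactors_iff hF]
  exact ⟨fun h => h.2.2, fun h => ⟨Q.2.2, Q.2.1, h⟩⟩

theorem monic_prod_primes (s : Finset (MonicPrime K)) : (∏ Q ∈ s, Q.1).Monic :=
  monic_prod_of_monic _ _ fun Q _ => Q.2.1

theorem squarefree_prod_primes (s : Finset (MonicPrime K)) : Squarefree (∏ Q ∈ s, Q.1) := by
  refine Finset.squarefree_prod_of_pairwise_isCoprime ?_ fun Q _ => Q.2.2.squarefree
  intro Q _ R _ hQR
  exact Q.2.2.isRelPrime_iff_not_dvd.2 fun h => hQR (MonicPrime.eq_of_dvd h)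

theorem primeDivisors_prod (s : Finset (MonicPrime K)) : primeDivisors (∏ Q ∈ s, Q.1) = s := by
  ext R
  rw [mem_primeDivisors (monic_prod_primes s).ne_zero, R.prime.dvd_finsetProd_iff]
  exact ⟨fun ⟨Q, hQ, h⟩ => MonicPrime.eq_of_dvd h ▸ hQ, fun h => ⟨R, h, dvd_rfl⟩⟩

open UniqueFactorizationMonoid in
theorem prod_primeDivisors {F : K[X]} (hF : F.Monic) (hs : Squarefree F) :
    ∏ Q ∈ primeDivisors F, Q.1 = F := by
  classical
  have hprime : ∀ Q ∈ primeFactors F, Q.Monic ∧ Irreducible Q := fun Q hQ => by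
    rw [mem_primeFactors, Polynomial.mem_normalizedFactors_iff hF.ne_zero] at hQ
    exact ⟨hQ.2.1, hQ.1⟩
  have hradical : ∏ Q ∈ primeDivisors F, Q.1 = radical F := by
    simp only [primeDivisors, radical]
    exact Finset.prod_subtype_of_mem id hprime
  refine eq_of_monic_of_associated (monic_prod_primes _) hF ?_
  exact hradical ▸ radical_associated hs.isRadical hF.ne_zero

theorem mem_primeDivisors_mul {F G : K[X]} (h : F * G ≠ 0) {Q : MonicPrime K} :
    Q ∈ primeDivisors (F * G) ↔ Q ∈ primeDivisors F ∨ Q ∈ primeDivisors G := by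
  rw [mem_primeDivisors h, mem_primeDivisors (left_ne_zero_of_mul h),
    mem_primeDivisors (right_ne_zero_of_mul h), Q.prime.dvd_mul]

theorem disjoint_primeDivisors {F G : K[X]} (h : Squarefree (F * G)) :
    Disjoint (primeDivisors F) (primeDivisors G) := by
  refine Finset.disjoint_left.2 fun Q hF hG => Q.2.2.not_isUnit (h Q.1 (mul_dvd_mul ?_ ?_))
  · exact (mem_primeDivisors (left_ne_zero_of_mul h.ne_zero)).1 hF
  · exact (mem_primeDivisors (right_ne_zero_of_mul h.ne_zero)).1 hG

open Classical in
theorem primeDivisors_mul_sdiff {F G : K[X]} (h : Squarefree (F * G)) :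
    primeDivisors (F * G) \ primeDivisors F = primeDivisors G := by
  ext Q
  have hdisjoint : Q ∈ primeDivisors G → Q ∉ primeDivisors F :=
    fun hG => Finset.disjoint_right.1 (disjoint_primeDivisors h) hG
  rw [Finset.mem_sdiff, mem_primeDivisors_mul h.ne_zero]
  tauto

theorem map_eq_prod_primeDivisors {A : Type*} [CommMonoid A] (ψ : K[X] →* A) {F : K[X]}
    (hF : F.Monic) (hs : Squarefree F) : ψ F = ∏ Q ∈ primeDivisors F, ψ Q.1 := by
  conv_lhs => rw [← prod_primeDivisors hF hs]
  exact map_prod ψ _ _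

theorem natDegree_eq_sum_primeDivisors {F : K[X]} (hF : F.Monic) (hs : Squarefree F) :
    F.natDegree = ∑ Q ∈ primeDivisors F, Q.1.natDegree := by
  conv_lhs => rw [← prod_primeDivisors hF hs]
  exact natDegree_prod_of_monic _ _ fun Q _ => Q.2.1

end PrimeDivisors

section FactorPairs

variable {K : Type*} [Field K]

open Classical in
/-- The factorizations of a square-free monic polynomial into two monic factors. -/
noncomputable def factorPairs (F : K[X]) : Finset (K[X] × K[X]) :=
  (primeDivisors F).powerset.image fun s => (∏ Q ∈ s, Q.1, ∏ Q ∈ primeDivisors F \ s, Q.1)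

theorem mem_factorPairs {F : K[X]} (hF : F.Monic) (hs : Squarefree F) {p : K[X] × K[X]} :
    p ∈ factorPairs F ↔ p.1.Monic ∧ p.2.Monic ∧ p.1 * p.2 = F := by
  classical
  simp only [factorPairs, Finset.mem_image, Finset.mem_powerset]
  constructor
  · rintro ⟨s, hsub, rfl⟩
    refine ⟨monic_prod_primes _, monic_prod_primes _, ?_⟩
    rw [mul_comm, Finset.prod_sdiff hsub, prod_primeDivisors hF hs]
  · rintro ⟨h1, h2, rfl⟩
    refine ⟨primeDivisors p.1, fun Q hQ => (mem_primeDivisors_mul hF.ne_zero).2 (.inl hQ), ?_⟩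
    rw [primeDivisors_mul_sdiff hs, prod_primeDivisors h1 hs.of_mul_left,
      prod_primeDivisors h2 hs.of_mul_right]

theorem sum_factorPairs {A : Type*} [CommSemiring A] (a b : MonicPrime K → A) (F : K[X]) :
    ∑ p ∈ factorPairs F, (∏ Q ∈ primeDivisors p.1, a Q) * ∏ Q ∈ primeDivisors p.2, b Q =
      ∏ Q ∈ primeDivisors F, (a Q + b Q) := by
  classical
  rw [factorPairs, Finset.sum_image, Finset.prod_add]
  · simp only [primeDivisors_prod]
  · intro s _ t _ h
    have hprod : ∏ Q ∈ s, Q.1 = ∏ Q ∈ t, Q.1 := (Prod.ext_iff.1 h).1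
    rw [← primeDivisors_prod s, hprod, primeDivisors_prod]

end FactorPairs

section Squarefree

variable {K : Type*} [Field K] [Fintype K]

variable (K) in
open Classical in
/-- The square-free monic polynomials of degree `d`. -/
noncomputable def sqfMonics (d : ℕ) : Finset K[X] := (monics K d).filter Squarefree

theorem mem_sqfMonics {d : ℕ} {F : K[X]} :
    F ∈ sqfMonics K d ↔ F.Monic ∧ F.natDegree = d ∧ Squarefree F := by
  simp [sqfMonics, mem_monics, and_assoc]

theorem sum_muSq_mul (f : K[X] → ℂ) (d : ℕ) :
    ∑ F ∈ monics K d, muSq F * f F = ∑ F ∈ sqfMonics K d, f F := by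
  classical
  rw [sqfMonics, Finset.sum_filter]
  exact Finset.sum_congr rfl fun F _ => by simp [muSq]

theorem injOn_primeDivisors (d : ℕ) :
    Set.InjOn (primeDivisors : K[X] → Finset (MonicPrime K)) (sqfMonics K d) := by
  intro F hF G hG h
  obtain ⟨hF, -, hFs⟩ := mem_sqfMonics.1 hF
  obtain ⟨hG, -, hGs⟩ := mem_sqfMonics.1 hG
  rw [← prod_primeDivisors hF hFs, h, prod_primeDivisors hG hGs]

open Classical in
theorem mem_image_primeDivisors (d : ℕ) (s : Finset (MonicPrime K)) :
    s ∈ (sqfMonics K d).image primeDivisors ↔ ∑ Q ∈ s, Q.1.natDegree = d := by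
  simp only [Finset.mem_image, mem_sqfMonics]
  constructor
  · rintro ⟨F, ⟨hF, hd, hs⟩, rfl⟩
    rw [← natDegree_eq_sum_primeDivisors hF hs, hd]
  · intro h
    refine ⟨∏ Q ∈ s, Q.1, ⟨monic_prod_primes s, ?_, squarefree_prod_primes s⟩, primeDivisors_prod s⟩
    rw [natDegree_prod_of_monic _ _ fun Q _ => Q.2.1, h]

theorem hasSum_sqfMonics {a : MonicPrime K → ℂ} {c : ℝ} (ha : ∀ Q, ‖a Q‖ ≤ c) {u : ℂ}
    (hu : Fintype.card K * ‖u‖ < 1) :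
    HasSum (fun d => (∑ F ∈ sqfMonics K d, ∏ Q ∈ primeDivisors F, a Q) * u ^ d)
      (∏' Q : MonicPrime K, (1 + a Q * u ^ Q.1.natDegree)) := by
  classical
  have hfinsets := summable_finsetProd_of_summable_norm (summable_norm_prime ha hu)
  rw [tprod_one_add hfinsets]
  refine (hasSum_sum_fiber mem_image_primeDivisors hfinsets.hasSum).congr_fun fun d => ?_
  rw [Finset.sum_image (injOn_primeDivisors d), Finset.sum_mul]
  refine Finset.sum_congr rfl fun F hF => ?_
  obtain ⟨hF, hd, hs⟩ := mem_sqfMonics.1 hF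
  rw [Finset.prod_mul_distrib, Finset.prod_pow_eq_pow_sum, ← natDegree_eq_sum_primeDivisors hF hs,
    hd]

variable (K) in
/-- The triples of monic polynomials whose product is square-free of degree `d`. -/
noncomputable def sqfTriples (d : ℕ) : Finset (K[X] × K[X] × K[X]) :=
  (finite_triples K d {t | t.1.Monic ∧ t.2.1.Monic ∧ t.2.2.Monic ∧
      t.1.natDegree + t.2.1.natDegree + t.2.2.natDegree = d ∧
      Squarefree (t.1 * t.2.1 * t.2.2)}
    fun _ ht => ht.2.2.2.1.le).toFinset

theorem mem_sqfTriples {d : ℕ} {t : K[X] × K[X] × K[X]} :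
    t ∈ sqfTriples K d ↔ t.1.Monic ∧ t.2.1.Monic ∧ t.2.2.Monic ∧
      t.1.natDegree + t.2.1.natDegree + t.2.2.natDegree = d ∧
      Squarefree (t.1 * t.2.1 * t.2.2) := by
  rw [sqfTriples, Set.Finite.mem_toFinset]
  rfl

theorem mem_sqfTriples_iff_factorPairs {d : ℕ} {F : K[X]} {p r : K[X] × K[X]} :
    F ∈ sqfMonics K d ∧ p ∈ factorPairs F ∧ r ∈ factorPairs p.2 ↔
      (p.1, r) ∈ sqfTriples K d ∧ p.2 = r.1 * r.2 ∧ F = p.1 * p.2 := by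
  rw [mem_sqfTriples, mem_sqfMonics]
  constructor
  · rintro ⟨⟨hF, rfl, hs⟩, hp, hr⟩
    obtain ⟨h1, h, rfl⟩ := (mem_factorPairs hF hs).1 hp
    obtain ⟨h2, h3, hr⟩ := (mem_factorPairs h hs.of_mul_right).1 hr
    rw [← hr, ← mul_assoc] at hs
    rw [h1.natDegree_mul h, ← hr, h2.natDegree_mul h3, ← add_assoc]
    exact ⟨⟨h1, h2, h3, rfl, hs⟩, rfl, rfl⟩
  · rintro ⟨⟨h1, h2, h3, rfl, hs⟩, hr, rfl⟩
    rw [mul_assoc] at hs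
    have h := h2.mul h3
    rw [hr, mem_factorPairs (h1.mul h) hs, hr, mem_factorPairs h hs.of_mul_right,
      h1.natDegree_mul h, h2.natDegree_mul h3, ← add_assoc]
    exact ⟨⟨h1.mul h, rfl, hs⟩, ⟨h1, h, rfl⟩, h2, h3, rfl⟩

theorem sum_sqfTriples_eq_sum_factorPairs {A : Type*} [AddCommMonoid A]
    (f : K[X] × K[X] × K[X] → A) (d : ℕ) :
    ∑ t ∈ sqfTriples K d, f t =
      ∑ F ∈ sqfMonics K d, ∑ p ∈ factorPairs F, ∑ r ∈ factorPairs p.2, f (p.1, r) := by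
  simp_rw [Finset.sum_sigma']
  refine Finset.sum_bij' (fun t _ => ⟨t.1 * (t.2.1 * t.2.2), (t.1, t.2.1 * t.2.2), t.2⟩)
    (fun x _ => (x.2.1.1, x.2.2)) ?_ ?_ ?_ ?_ ?_
  · intro t ht
    simp only [Finset.mem_sigma]
    exact mem_sqfTriples_iff_factorPairs.2 ⟨ht, rfl, rfl⟩
  · rintro ⟨F, p, r⟩ hx
    simp only [Finset.mem_sigma] at hx
    exact (mem_sqfTriples_iff_factorPairs.1 hx).1
  · exact fun _ _ => rfl
  · rintro ⟨F, p, r⟩ hx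
    simp only [Finset.mem_sigma] at hx
    obtain ⟨-, hp, rfl⟩ := mem_sqfTriples_iff_factorPairs.1 hx
    simp only [← hp]
  · exact fun _ _ => rfl

/-- The sum of `ψ₁(f₁) ψ₂(f₂)` over the triples of monic polynomials whose product is square-free
of degree `d`. -/
noncomputable def tripleSum {A : Type*} [CommSemiring A] (ψ₁ ψ₂ : K[X] →* A) (d : ℕ) : A :=
  ∑ t ∈ sqfTriples K d, ψ₁ t.1 * ψ₂ t.2.1

theorem tripleSum_eq_sum_sqfMonics {A : Type*} [CommSemiring A] (ψ₁ ψ₂ : K[X] →* A) (d : ℕ) :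
    tripleSum ψ₁ ψ₂ d =
      ∑ F ∈ sqfMonics K d, ∏ Q ∈ primeDivisors F, (ψ₁ Q.1 + ψ₂ Q.1 + 1) := by
  have hexpand (t) (ht : t ∈ sqfTriples K d) : ψ₁ t.1 * ψ₂ t.2.1 =
      (∏ Q ∈ primeDivisors t.1, ψ₁ Q.1) *
        ((∏ Q ∈ primeDivisors t.2.1, ψ₂ Q.1) * ∏ Q ∈ primeDivisors t.2.2, 1) := by
    obtain ⟨h1, h2, -, -, hs⟩ := mem_sqfTriples.1 ht
    rw [← map_eq_prod_primeDivisors ψ₁ h1 hs.of_mul_left.of_mul_left,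
      ← map_eq_prod_primeDivisors ψ₂ h2 hs.of_mul_left.of_mul_right, Finset.prod_const_one,
      mul_one]
  rw [tripleSum, Finset.sum_congr rfl hexpand, sum_sqfTriples_eq_sum_factorPairs]
  simp_rw [add_assoc, ← sum_factorPairs, Finset.mul_sum]

theorem tripleSum_comm {A : Type*} [CommSemiring A] (ψ₁ ψ₂ : K[X] →* A) (d : ℕ) :
    tripleSum ψ₁ ψ₂ d = tripleSum ψ₂ ψ₁ d := by
  simp_rw [tripleSum_eq_sum_sqfMonics, add_comm (ψ₁ _)]

end Squarefree

section PowerSeries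

theorem hasFPowerSeriesAt_ofScalars {f : ℂ → ℂ} {S : ℕ → ℂ}
    (h : ∀ᶠ u in 𝓝 (0 : ℂ), HasSum (fun d => S d * u ^ d) (f u)) :
    HasFPowerSeriesAt f (FormalMultilinearSeries.ofScalars ℂ S) 0 := by
  rw [hasFPowerSeriesAt_iff]
  filter_upwards [h] with u hu
  simpa [FormalMultilinearSeries.coeff_ofScalars, mul_comm] using hu

theorem eq_of_hasSum_mul_pow {f : ℂ → ℂ} {S T : ℕ → ℂ}
    (hS : ∀ᶠ u in 𝓝 (0 : ℂ), HasSum (fun d => S d * u ^ d) (f u))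
    (hT : ∀ᶠ u in 𝓝 (0 : ℂ), HasSum (fun d => T d * u ^ d) (f u)) : S = T := by
  have h := (hasFPowerSeriesAt_ofScalars hS).eq_formalMultilinearSeries
    (hasFPowerSeriesAt_ofScalars hT)
  funext d
  simpa [FormalMultilinearSeries.coeff_ofScalars] using congrArg (fun p => p.coeff d) h

theorem norm_coeff_le_of_differentiableOn {f : ℂ → ℂ} {S : ℕ → ℂ} {r : ℝ} (hr : 0 < r)
    (hf : DifferentiableOn ℂ f (Metric.closedBall 0 r))
    (hS : ∀ᶠ u in 𝓝 (0 : ℂ), HasSum (fun d => S d * u ^ d) (f u)) :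
    ∃ A, ∀ d, ‖S d‖ ≤ A * r⁻¹ ^ d := by
  lift r to NNReal using hr.le
  have hcauchy := (hf.hasFPowerSeriesOnBall (by exact_mod_cast hr)).hasFPowerSeriesAt
  have hbound := norm_cauchyPowerSeries_le f 0 r
  simp only [← (hasFPowerSeriesAt_ofScalars hS).eq_formalMultilinearSeries hcauchy,
    FormalMultilinearSeries.ofScalars_norm, abs_of_pos hr] at hbound
  exact ⟨_, hbound⟩

/-- The size `q^{(1/2 + ε) d}` of the error terms. -/
noncomputable def errorScale (q ε : ℝ) (d : ℕ) : ℝ := q ^ ((1 / 2 + ε) * (d : ℝ))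

variable {q ε : ℝ}

theorem isBigO_errorScale_of_hasSum (hq : 1 < q) (hε : 0 < ε) {f : ℂ → ℂ} {S : ℕ → ℂ}
    (hf : DifferentiableOn ℂ f (Metric.ball 0 (q ^ (-(1 / 2) : ℝ))))
    (hS : ∀ᶠ u in 𝓝 (0 : ℂ), HasSum (fun d => S d * u ^ d) (f u)) :
    S =O[⊤] errorScale q ε := by
  have hq0 : 0 < q := one_pos.trans hq
  have hr : q ^ (-(1 / 2 + ε)) < q ^ (-(1 / 2) : ℝ) :=
    Real.rpow_lt_rpow_of_exponent_lt hq (by linarith)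
  obtain ⟨A, hA⟩ := norm_coeff_le_of_differentiableOn (Real.rpow_pos_of_pos hq0 _)
    (hf.mono (Metric.closedBall_subset_ball hr)) hS
  refine .of_bound A (.of_forall fun d => (hA d).trans_eq ?_)
  rw [errorScale, Real.norm_of_nonneg (by positivity), ← Real.rpow_neg hq0.le, neg_neg,
    Real.rpow_mul_natCast hq0.le]

theorem hasSum_sub_pole {q u D : ℂ} {T : ℕ → ℂ} {G : ℂ → ℂ} (hu : ‖q * u‖ < 1)
    (hT : HasSum (fun d => T d * u ^ d) D) (hD : D * (1 - q * u) = G u) :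
    HasSum (fun d => (T d - G q⁻¹ * q ^ d) * u ^ d) ((G u - G q⁻¹) * (1 - q * u)⁻¹) := by
  have hne : 1 - q * u ≠ 0 := fun h => by
    rw [← sub_eq_zero.1 h, norm_one] at hu
    exact lt_irrefl _ hu
  have hsum : D - G q⁻¹ * (1 - q * u)⁻¹ = (G u - G q⁻¹) * (1 - q * u)⁻¹ := by
    rw [← hD, sub_mul, mul_inv_cancel_right₀ hne]
  rw [← hsum]
  refine (hT.sub ((hasSum_geometric_of_norm_lt_one hu).mul_left (G q⁻¹))).congr_fun fun d => ?_
  rw [mul_pow]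
  ring

theorem eventually_mul_norm_lt_one (q : ℝ) : ∀ᶠ u in 𝓝 (0 : ℂ), q * ‖u‖ < 1 :=
  (isOpen_lt (f := fun u : ℂ => q * ‖u‖) (by fun_prop) continuous_const).mem_nhds (by simp)

theorem isBigO_sub_pole (hq : 1 < q) (hε : 0 < ε) {T : ℕ → ℂ} {G D : ℂ → ℂ}
    (hG : DifferentiableOn ℂ G (Metric.ball 0 (q ^ (-(1 / 2) : ℝ))))
    (hT : ∀ u : ℂ, q * ‖u‖ < 1 → HasSum (fun d => T d * u ^ d) (D u))
    (hD : ∀ u : ℂ, q * ‖u‖ < 1 → D u * (1 - q * u) = G u) :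
    (fun d => T d - G (q : ℂ)⁻¹ * (q : ℂ) ^ d) =O[⊤] errorScale q ε := by
  have hq0 : 0 < q := one_pos.trans hq
  have hpole : (q : ℂ)⁻¹ ∈ Metric.ball 0 (q ^ (-(1 / 2) : ℝ)) := by
    rw [mem_ball_zero_iff, norm_inv, Complex.norm_of_nonneg hq0.le, ← Real.rpow_neg_one]
    exact Real.rpow_lt_rpow_of_exponent_lt hq (by norm_num)
  have hdslope : DifferentiableOn ℂ (fun u => -(q : ℂ)⁻¹ * dslope G (q : ℂ)⁻¹ u)
      (Metric.ball 0 (q ^ (-(1 / 2) : ℝ))) :=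
    ((Complex.differentiableOn_dslope (Metric.isOpen_ball.mem_nhds hpole)).2 hG).const_mul _
  refine isBigO_errorScale_of_hasSum hq hε hdslope ?_
  filter_upwards [eventually_mul_norm_lt_one q] with u hu
  have hqu : ‖(q : ℂ) * u‖ < 1 := by rwa [norm_mul, Complex.norm_of_nonneg hq0.le]
  convert hasSum_sub_pole hqu (hT u hu) (hD u hu) using 1
  have hqc : (q : ℂ) ≠ 0 := by exact_mod_cast hq0.ne'
  have hne : 1 - (q : ℂ) * u ≠ 0 := fun h => by simp [← sub_eq_zero.1 h] at hqu
  rw [eq_mul_inv_iff_mul_eq₀ hne, ← sub_smul_dslope, smul_eq_mul]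
  field_simp
  ring

theorem mul_sq_lt_one (hq : 0 < q) {ρ : ℝ} (h0 : 0 ≤ ρ) (hρ : ρ < q ^ (-(1 / 2) : ℝ)) :
    q * ρ ^ 2 < 1 := by
  have hsq : (q ^ (-(1 / 2) : ℝ)) ^ 2 = q⁻¹ := by
    rw [← Real.rpow_mul_natCast hq.le, ← Real.rpow_neg_one]
    norm_num
  calc q * ρ ^ 2 < q * (q ^ (-(1 / 2) : ℝ)) ^ 2 := by gcongr
    _ = 1 := by rw [hsq, mul_inv_cancel₀ hq.ne']

end PowerSeries

section LocalFactor

theorem norm_prod_sub_one_le {a b c x : ℂ} (ha : ‖a‖ ≤ 1) (hb : ‖b‖ ≤ 1) (hc : ‖c‖ ≤ 1)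
    (hx : ‖x‖ ≤ 1) :
    ‖(1 + (a + b + c) * x) * (1 - a * x) * (1 - b * x) * (1 - c * x) - 1‖ ≤ 25 * ‖x‖ ^ 2 := by
  obtain ⟨e₁, he₁⟩ : ∃ e, e = a + b + c := ⟨_, rfl⟩
  obtain ⟨e₂, he₂⟩ : ∃ e, e = a * b + a * c + b * c := ⟨_, rfl⟩
  obtain ⟨e₃, he₃⟩ : ∃ e, e = a * b * c := ⟨_, rfl⟩
  have h₁ : ‖e₁‖ ≤ 3 := he₁ ▸ norm_add₃_le.trans (by linarith)
  have hmul {y z : ℂ} (hy : ‖y‖ ≤ 1) (hz : ‖z‖ ≤ 1) : ‖y * z‖ ≤ 1 :=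
    norm_mul y z ▸ mul_le_one₀ hy (norm_nonneg z) hz
  have h₂ : ‖e₂‖ ≤ 3 :=
    he₂ ▸ norm_add₃_le.trans (by linarith [hmul ha hb, hmul ha hc, hmul hb hc])
  have h₃ : ‖e₃‖ ≤ 1 := he₃ ▸ hmul (hmul ha hb) hc
  have hexpand : (1 + (a + b + c) * x) * (1 - a * x) * (1 - b * x) * (1 - c * x) - 1 =
      (e₂ - e₁ ^ 2 + (e₁ * e₂ - e₃) * x - e₁ * e₃ * x ^ 2) * x ^ 2 := by
    rw [he₁, he₂, he₃]
    ring
  rw [hexpand, norm_mul, norm_pow]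
  gcongr
  calc ‖e₂ - e₁ ^ 2 + (e₁ * e₂ - e₃) * x - e₁ * e₃ * x ^ 2‖
      ≤ ‖e₂‖ + ‖e₁‖ ^ 2 + (‖e₁‖ * ‖e₂‖ + ‖e₃‖) * ‖x‖ + ‖e₁‖ * ‖e₃‖ * ‖x‖ ^ 2 := by
        rw [← norm_pow, ← norm_pow, ← norm_mul, ← norm_mul, ← norm_mul]
        refine (norm_sub_le _ _).trans (add_le_add ((norm_add_le _ _).trans ?_) le_rfl)
        rw [norm_mul]
        gcongr <;> exact norm_sub_le _ _
    _ ≤ 3 + 3 ^ 2 + (3 * 3 + 1) * 1 + 3 * 1 * 1 ^ 2 := by gcongr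
    _ = 25 := by norm_num

variable {K : Type*} [Field K]

/-- The quotient of the local factor at `Q` of `∏_Q (1 + (ψ₁(Q) + ψ₂(Q) + 1) u^{deg Q})` by that of
`L(u, ψ₁) L(u, ψ₂) Z(u)`. -/
noncomputable def localFactor (ψ₁ ψ₂ : K[X] → ℂ) (u : ℂ) (Q : MonicPrime K) : ℂ :=
  (1 + (ψ₁ Q.1 + ψ₂ Q.1 + 1) * u ^ Q.1.natDegree) * (1 - ψ₁ Q.1 * u ^ Q.1.natDegree) *
    (1 - ψ₂ Q.1 * u ^ Q.1.natDegree) * (1 - 1 * u ^ Q.1.natDegree)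

theorem differentiable_localFactor (ψ₁ ψ₂ : K[X] → ℂ) (Q : MonicPrime K) :
    Differentiable ℂ fun u => localFactor ψ₁ ψ₂ u Q := by
  unfold localFactor
  fun_prop

section Cardinality

variable (K) [Fintype K]

theorem card_pos_real : (0 : ℝ) < Fintype.card K := by
  exact_mod_cast Fintype.card_pos

variable {K}

theorem le_one_of_lt_card_rpow {ρ : ℝ} (hρ : ρ < (Fintype.card K : ℝ) ^ (-(1 / 2) : ℝ)) : ρ ≤ 1 :=
  hρ.le.trans (Real.rpow_le_one_of_one_le_of_nonpos
    (by exact_mod_cast Fintype.card_pos) (by norm_num))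

end Cardinality

section Convergence

variable {ψ₁ ψ₂ : K[X] → ℂ} (h₁ : ∀ F, ‖ψ₁ F‖ ≤ 1) (h₂ : ∀ F, ‖ψ₂ F‖ ≤ 1)

include h₁ h₂

theorem norm_localFactor_sub_one_le {u : ℂ} {ρ : ℝ} (hu : ‖u‖ ≤ ρ) (hρ : ρ ≤ 1)
    (Q : MonicPrime K) : ‖localFactor ψ₁ ψ₂ u Q - 1‖ ≤ 25 * (ρ ^ 2) ^ Q.1.natDegree := by
  refine (norm_prod_sub_one_le (h₁ _) (h₂ _) norm_one.le ?_).trans ?_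
  · rw [norm_pow]
    exact pow_le_one₀ (norm_nonneg _) (hu.trans hρ)
  · rw [norm_pow, pow_right_comm]
    gcongr

variable [Fintype K]

theorem summable_norm_localFactor_sub_one {u : ℂ}
    (hu : ‖u‖ < (Fintype.card K : ℝ) ^ (-(1 / 2) : ℝ)) :
    Summable fun Q => ‖localFactor ψ₁ ψ₂ u Q - 1‖ :=
  .of_nonneg_of_le (fun _ => norm_nonneg _)
    (norm_localFactor_sub_one_le h₁ h₂ le_rfl (le_one_of_lt_card_rpow hu))
    ((summable_prime_pow_natDegree (sq_nonneg _)
      (mul_sq_lt_one (card_pos_real K) (norm_nonneg u) hu)).mul_left 25)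

theorem multipliable_localFactor {u : ℂ} (hu : ‖u‖ < (Fintype.card K : ℝ) ^ (-(1 / 2) : ℝ)) :
    Multipliable (localFactor ψ₁ ψ₂ u) := by
  simpa using multipliable_one_add_of_summable (summable_norm_localFactor_sub_one h₁ h₂ hu)

theorem differentiableOn_tprod_localFactor :
    DifferentiableOn ℂ (fun u => ∏' Q, localFactor ψ₁ ψ₂ u Q)
      (Metric.ball 0 ((Fintype.card K : ℝ) ^ (-(1 / 2) : ℝ))) := by
  intro u hu
  obtain ⟨ρ, huρ, hρ⟩ := exists_between (mem_ball_zero_iff.1 hu)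
  have hρ0 : 0 ≤ ρ := (norm_nonneg u).trans huρ.le
  have hprod := Summable.hasProdLocallyUniformlyOn_one_add
    (f := fun (Q : MonicPrime K) u => localFactor ψ₁ ψ₂ u Q - 1)
    (Metric.isOpen_ball (x := (0 : ℂ)) (ε := ρ))
    ((summable_prime_pow_natDegree (sq_nonneg ρ)
      (mul_sq_lt_one (card_pos_real K) hρ0 hρ)).mul_left 25)
    (.of_forall fun Q v hv => norm_localFactor_sub_one_le h₁ h₂ (mem_ball_zero_iff.1 hv).le
      (le_one_of_lt_card_rpow hρ) Q)
    (fun Q => ((differentiable_localFactor ψ₁ ψ₂ Q).sub_const 1).continuous.continuousOn)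
  simp only [add_sub_cancel] at hprod
  have hdiff : DifferentiableOn ℂ (fun u => ∏' Q, localFactor ψ₁ ψ₂ u Q) (Metric.ball 0 ρ) :=
    TendstoLocallyUniformlyOn.differentiableOn hprod
      (.of_forall fun S => .fun_finsetProd fun Q _ =>
        (differentiable_localFactor ψ₁ ψ₂ Q).differentiableOn) Metric.isOpen_ball
  exact (hdiff.differentiableAt
    (Metric.isOpen_ball.mem_nhds (mem_ball_zero_iff.2 huρ))).differentiableWithinAt

end Convergence

end LocalFactor

section MeanValue

variable {K : Type*} [Field K] [Fintype K]

theorem multipliable_one_add_mul_pow {a : MonicPrime K → ℂ} {c : ℝ} (ha : ∀ Q, ‖a Q‖ ≤ c) {u : ℂ}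
    (hu : Fintype.card K * ‖u‖ < 1) :
    Multipliable fun Q : MonicPrime K => 1 + a Q * u ^ Q.1.natDegree :=
  multipliable_one_add_of_summable (summable_norm_prime ha hu)

theorem multipliable_one_sub_mul_pow {a : MonicPrime K → ℂ} {c : ℝ} (ha : ∀ Q, ‖a Q‖ ≤ c) {u : ℂ}
    (hu : Fintype.card K * ‖u‖ < 1) :
    Multipliable fun Q : MonicPrime K => 1 - a Q * u ^ Q.1.natDegree := by
  simpa only [neg_mul, ← sub_eq_add_neg] using
    multipliable_one_add_mul_pow (a := fun Q => -a Q) (fun Q => (norm_neg (a Q)).trans_le (ha Q)) hu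

theorem tprod_one_sub_pow {u : ℂ} (hu : Fintype.card K * ‖u‖ < 1) :
    ∏' Q : MonicPrime K, (1 - u ^ Q.1.natDegree) = 1 - Fintype.card K * u := by
  have h := genSeries_mul_tprod_one_sub (ψ := (1 : K[X] →* ℂ)) (fun _ => norm_one.le) hu
  have hZ : genSeries (1 : K[X] →* ℂ) u = (1 - Fintype.card K * u)⁻¹ := Z_eq hu
  simp only [hZ, MonoidHom.one_apply, one_mul] at h
  exact ((inv_mul_eq_one₀ fun h0 => by simp [h0] at h).1 h).symm

theorem differentiable_genSeries {ψ : K[X] → ℂ}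
    (h : ∀ᶠ d in atTop, ∑ F ∈ monics K d, ψ F = 0) : Differentiable ℂ (genSeries ψ) := by
  obtain ⟨m, hm⟩ := eventually_atTop.1 h
  have hpoly : genSeries ψ = fun u => ∑ d ∈ Finset.range m, (∑ F ∈ monics K d, ψ F) * u ^ d := by
    funext u
    refine tsum_eq_sum fun d hd => ?_
    rw [hm d (by simpa using hd), zero_mul]
  rw [hpoly]
  fun_prop

variable (ψ₁ ψ₂ : K[X] →* ℂ)

/-- The constant `c` such that `c q ^ d` is the main term of `tripleSum ψ₁ ψ₂ d`. -/
noncomputable def meanValue : ℂ :=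
  genSeries ψ₁ (Fintype.card K : ℂ)⁻¹ * genSeries ψ₂ (Fintype.card K : ℂ)⁻¹ *
    ∏' Q, localFactor ψ₁ ψ₂ (Fintype.card K : ℂ)⁻¹ Q

variable {ψ₁ ψ₂} (h₁ : ∀ F, ‖ψ₁ F‖ ≤ 1) (h₂ : ∀ F, ‖ψ₂ F‖ ≤ 1)

include h₁ h₂

omit [Fintype K] in
theorem norm_add_add_one_le (F : K[X]) : ‖ψ₁ F + ψ₂ F + 1‖ ≤ 3 :=
  norm_add₃_le.trans (by linarith [h₁ F, h₂ F, norm_one (α := ℂ)])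

theorem tprod_mul_one_sub {u : ℂ} (hu : Fintype.card K * ‖u‖ < 1) :
    (∏' Q : MonicPrime K, (1 + (ψ₁ Q.1 + ψ₂ Q.1 + 1) * u ^ Q.1.natDegree)) *
        (1 - Fintype.card K * u) =
      genSeries ψ₁ u * genSeries ψ₂ u * ∏' Q, localFactor ψ₁ ψ₂ u Q := by
  have hm := multipliable_one_add_mul_pow (fun Q : MonicPrime K => norm_add_add_one_le h₁ h₂ Q.1) hu
  have hm₁ := multipliable_one_sub_mul_pow (fun Q : MonicPrime K => h₁ Q.1) hu
  have hm₂ := multipliable_one_sub_mul_pow (fun Q : MonicPrime K => h₂ Q.1) hu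
  have hm₃ := multipliable_one_sub_mul_pow (fun _ : MonicPrime K => norm_one (α := ℂ).le) hu
  simp only [localFactor]
  rw [((hm.mul hm₁).mul hm₂).tprod_mul hm₃, (hm.mul hm₁).tprod_mul hm₂, hm.tprod_mul hm₁]
  simp only [one_mul]
  rw [tprod_one_sub_pow hu]
  have hL₁ := genSeries_mul_tprod_one_sub h₁ hu
  have hL₂ := genSeries_mul_tprod_one_sub h₂ hu
  set D := ∏' Q : MonicPrime K, (1 + (ψ₁ Q.1 + ψ₂ Q.1 + 1) * u ^ Q.1.natDegree)
  set E₁ := ∏' Q : MonicPrime K, (1 - ψ₁ Q.1 * u ^ Q.1.natDegree)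
  set E₂ := ∏' Q : MonicPrime K, (1 - ψ₂ Q.1 * u ^ Q.1.natDegree)
  calc D * (1 - Fintype.card K * u)
      = (genSeries ψ₁ u * E₁) * (genSeries ψ₂ u * E₂) * (D * (1 - Fintype.card K * u)) := by
        rw [hL₁, hL₂, one_mul, one_mul]
    _ = genSeries ψ₁ u * genSeries ψ₂ u * (D * E₁ * E₂ * (1 - Fintype.card K * u)) := by ring

theorem isBigO_tripleSum_sub (hv₁ : ∀ᶠ d in atTop, ∑ F ∈ monics K d, ψ₁ F = 0)
    (hv₂ : ∀ᶠ d in atTop, ∑ F ∈ monics K d, ψ₂ F = 0) {ε : ℝ} (hε : 0 < ε) :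
    (fun d => tripleSum ψ₁ ψ₂ d - meanValue ψ₁ ψ₂ * Fintype.card K ^ d) =O[⊤]
      errorScale (Fintype.card K) ε := by
  have hL := (differentiable_genSeries hv₁).mul (differentiable_genSeries hv₂)
  have hG := hL.differentiableOn.mul (differentiableOn_tprod_localFactor h₁ h₂)
  have h := isBigO_sub_pole (by exact_mod_cast Fintype.one_lt_card) hε hG
    (fun u hu => hasSum_sqfMonics (fun Q => norm_add_add_one_le h₁ h₂ Q.1) hu)
    (fun u hu => by exact_mod_cast tprod_mul_one_sub h₁ h₂ hu)
  simpa only [← tripleSum_eq_sum_sqfMonics, Complex.ofReal_natCast, Pi.mul_apply, meanValue] using h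

end MeanValue

section SquarefreeCount

variable {K : Type*} [Field K] [Fintype K]

theorem tprod_one_add_pow_mul_one_sub {u : ℂ} (hu : Fintype.card K * ‖u‖ < 1) :
    (∏' Q : MonicPrime K, (1 + u ^ Q.1.natDegree)) * (1 - Fintype.card K * u) =
      1 - Fintype.card K * u ^ 2 := by
  have hu1 : ‖u‖ ≤ 1 := (le_mul_of_one_le_left (norm_nonneg u)
    (by exact_mod_cast Fintype.card_pos)).trans hu.le
  have hu2 : Fintype.card K * ‖u ^ 2‖ < 1 := by
    rw [norm_pow]
    exact hu.trans_le' (by gcongr; exact pow_le_of_le_one (norm_nonneg u) hu1 two_ne_zero)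
  have hadd := multipliable_one_add_mul_pow (fun _ : MonicPrime K => norm_one (α := ℂ).le) hu
  have hsub := multipliable_one_sub_mul_pow (fun _ : MonicPrime K => norm_one (α := ℂ).le) hu
  simp only [one_mul] at hadd hsub
  rw [← tprod_one_sub_pow hu, ← tprod_one_sub_pow hu2, ← hadd.tprod_mul hsub]
  refine tprod_congr fun Q => ?_
  rw [pow_right_comm]
  ring

theorem hasSum_coeff_mul_pow (p : ℂ[X]) (u : ℂ) : HasSum (fun d => p.coeff d * u ^ d) (p.eval u) :=
  eval_eq_sum_range (p := p) u ▸ hasSum_sum_of_ne_finset_zero fun d hd => by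
    rw [coeff_eq_zero_of_natDegree_lt (by simpa using hd), zero_mul]

theorem inv_zetaQ_two : (zetaQ K 2)⁻¹ = 1 - (Fintype.card K : ℂ)⁻¹ := by
  have hq : (1 : ℝ) < Fintype.card K := by exact_mod_cast Fintype.one_lt_card
  have hpow : (Fintype.card K : ℂ) ^ (-2 : ℂ) = ((Fintype.card K : ℂ) ^ 2)⁻¹ := by
    rw [Complex.cpow_neg, Complex.cpow_ofNat]
  rw [zetaQ, hpow, Z_eq, inv_inv]
  · field_simp
  · rw [norm_inv, norm_pow, Complex.norm_natCast, ← div_eq_mul_inv, div_lt_one (by positivity)]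
    exact lt_self_pow₀ hq one_lt_two

theorem card_sqfMonics {n : ℕ} (hn : 2 ≤ n) :
    ((sqfMonics K n).card : ℂ) = Fintype.card K ^ n / zetaQ K 2 := by
  set q := (Fintype.card K : ℂ) with hq
  have hq0 : q ≠ 0 := Nat.cast_ne_zero.2 Fintype.card_ne_zero
  have hcoeff : (fun d => ((sqfMonics K d).card : ℂ) - (1 - q * q⁻¹ ^ 2) * q ^ d) =
      fun d => (Polynomial.C q⁻¹ + X).coeff d := by
    refine eq_of_hasSum_mul_pow ?_ (.of_forall fun u => hasSum_coeff_mul_pow _ u)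
    filter_upwards [eventually_mul_norm_lt_one (Fintype.card K)] with u hu
    have hqu : ‖q * u‖ < 1 := by rwa [norm_mul, hq, Complex.norm_natCast]
    have hT := hasSum_sqfMonics (a := fun _ : MonicPrime K => 1) (fun _ => norm_one.le) hu
    simp only [Finset.prod_const_one, Finset.sum_const, nsmul_one, one_mul] at hT
    convert hasSum_sub_pole (G := fun u => 1 - q * u ^ 2) hqu hT
      (tprod_one_add_pow_mul_one_sub hu) using 1
    have hne : 1 - q * u ≠ 0 := fun h => by simp [← sub_eq_zero.1 h] at hqu
    rw [eval_add, eval_C, eval_X, eq_mul_inv_iff_mul_eq₀ hne]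
    field_simp
    ring
  have h := congrFun hcoeff n
  rw [coeff_eq_zero_of_natDegree_lt ((natDegree_C_add.trans natDegree_X).trans_lt hn),
    sub_eq_zero] at h
  rw [h, div_eq_mul_inv, inv_zetaQ_two, ← hq]
  field_simp

end SquarefreeCount

section Characters

variable {K : Type*} [Field K] [Fintype K]

theorem add_mem_monics {d : ℕ} {F r : K[X]} (hr : r.degree < d) (hF : F ∈ monics K d) :
    F + r ∈ monics K d := by
  rw [mem_monics] at hF ⊢
  have hdeg : r.degree < F.degree := by rwa [degree_eq_natDegree hF.1.ne_zero, hF.2]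
  exact ⟨hF.1.add_of_left hdeg, by rw [natDegree_add_eq_left_of_degree_lt hdeg, hF.2]⟩

theorem sum_monics_add {A : Type*} [AddCommMonoid A] (f : K[X] → A) {d : ℕ} {r : K[X]}
    (hr : r.degree < d) : ∑ F ∈ monics K d, f (F + r) = ∑ F ∈ monics K d, f F := by
  refine Finset.sum_equiv (Equiv.addRight r) (fun F => ⟨add_mem_monics hr, fun h => ?_⟩)
    fun F _ => rfl
  simpa using add_mem_monics (r := -r) (by rwa [degree_neg]) h

omit [Fintype K] in
theorem exists_degree_lt_mk_eq {P : K[X]} (hP : P ≠ 0) (a : AdjoinRoot P) :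
    ∃ r : K[X], r.degree < P.natDegree ∧ AdjoinRoot.mk P r = a := by
  obtain ⟨s, rfl⟩ := AdjoinRoot.mk_surjective a
  refine ⟨s % P, degree_eq_natDegree hP ▸ degree_mod_lt s hP, ?_⟩
  rw [EuclideanDomain.mod_eq_sub_mul_div, map_sub, map_mul, AdjoinRoot.mk_self, zero_mul, sub_zero]

theorem sum_monics_comp_mk_eq_zero {A : Type*} [AddCommMonoid A] [IsAddTorsionFree A]
    {P : K[X]} [Fintype (AdjoinRoot P)] (hP : P ≠ 0) {φ : AdjoinRoot P → A} (hφ : ∑ a, φ a = 0)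
    {d : ℕ} (hd : P.natDegree ≤ d) : ∑ F ∈ monics K d, φ (AdjoinRoot.mk P F) = 0 := by
  have hshift (a : AdjoinRoot P) :
      ∑ F ∈ monics K d, φ (AdjoinRoot.mk P F + a) = ∑ F ∈ monics K d, φ (AdjoinRoot.mk P F) := by
    obtain ⟨r, hr, rfl⟩ := exists_degree_lt_mk_eq hP a
    simp_rw [← map_add]
    exact sum_monics_add (fun F => φ (AdjoinRoot.mk P F)) (hr.trans_le (by exact_mod_cast hd))
  have hsum : ∑ a, ∑ F ∈ monics K d, φ (AdjoinRoot.mk P F + a) = 0 := by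
    rw [Finset.sum_comm]
    exact Finset.sum_eq_zero fun F _ =>
      (Equiv.sum_comp (Equiv.addLeft (AdjoinRoot.mk P F)) φ).trans hφ
  simp only [hshift, Finset.sum_const, Finset.card_univ] at hsum
  exact (nsmul_eq_zero_iff_right Fintype.card_ne_zero).1 hsum

omit [Fintype K] in
theorem finite_adjoinRoot [Finite K] {P : K[X]} (hP : P ≠ 0) : Finite (AdjoinRoot P) :=
  have : Module.Finite K (AdjoinRoot P) := (AdjoinRoot.powerBasis hP).finite
  Module.finite_of_finite K

omit [Fintype K] in
theorem chi_eq_quadraticChar (P : K[X]) [Fact (Irreducible P)] [Fintype (AdjoinRoot P)]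
    [DecidableEq (AdjoinRoot P)] (F : K[X]) :
    chi P F = (quadraticChar (AdjoinRoot P) (AdjoinRoot.mk P F) : ℤ) := by
  rw [quadraticChar_apply, chi]
  congr!

omit [Fintype K] in
theorem norm_chi_le (P F : K[X]) : ‖chi P F‖ ≤ 1 := by
  unfold chi quadraticCharFun
  split_ifs <;> simp

omit [Fintype K] in
theorem norm_chiMinus_le (P F : K[X]) : ‖chiMinus P F‖ ≤ 1 := by
  simpa [chiMinus] using norm_chi_le P F

/-- The quadratic character `χ_P = χ_P^+` as a completely multiplicative function. -/
noncomputable def chiHom {P : K[X]} (hP : Irreducible P) : K[X] →* ℂ where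
  toFun := chi P
  map_one' := by
    have := Fact.mk hP
    simp [chi, quadraticCharFun]
  map_mul' F G := by
    classical
    have := Fact.mk hP
    have := finite_adjoinRoot hP.ne_zero
    have := Fintype.ofFinite (AdjoinRoot P)
    simp only [chi_eq_quadraticChar, map_mul, Int.cast_mul]

@[simp]
theorem coe_chiHom {P : K[X]} (hP : Irreducible P) : ⇑(chiHom hP) = chi P := rfl

/-- The twisted character `χ_P^-` as a completely multiplicative function. -/
noncomputable def chiMinusHom {P : K[X]} (hP : Irreducible P) : K[X] →* ℂ where
  toFun := chiMinus P
  map_one' := by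
    rw [chiMinus, natDegree_one, pow_zero, one_mul, ← coe_chiHom hP, map_one]
  map_mul' F G := by
    rcases eq_or_ne (F * G) 0 with h | h
    · have hzero : chi P 0 = 0 := by simp [chi, quadraticCharFun]
      rcases mul_eq_zero.1 h with rfl | rfl <;> simp [chiMinus, hzero]
    · rw [chiMinus, natDegree_mul (left_ne_zero_of_mul h) (right_ne_zero_of_mul h),
        ← coe_chiHom hP, map_mul, pow_add, mul_mul_mul_comm]
      rfl

@[simp]
theorem coe_chiMinusHom {P : K[X]} (hP : Irreducible P) : ⇑(chiMinusHom hP) = chiMinus P := rfl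

theorem ringChar_adjoinRoot_ne_two (hq : Odd (Fintype.card K)) (P : K[X]) [Fact (Irreducible P)] :
    ringChar (AdjoinRoot P) ≠ 2 := by
  rw [← Algebra.ringChar_eq K (AdjoinRoot P), Ne, FiniteField.even_card_iff_char_two,
    ← Nat.even_iff, Nat.not_even_iff_odd]
  exact hq

variable {P : K[X]} {d : ℕ}

theorem sum_chi_eq_zero (hq : Odd (Fintype.card K)) (hP : Irreducible P) (hd : P.natDegree ≤ d) :
    ∑ F ∈ monics K d, chi P F = 0 := by
  classical
  have := Fact.mk hP
  have := finite_adjoinRoot hP.ne_zero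
  have := Fintype.ofFinite (AdjoinRoot P)
  have hsum := sum_monics_comp_mk_eq_zero hP.ne_zero
    (quadraticChar_sum_zero (ringChar_adjoinRoot_ne_two hq P)) hd
  simp only [chi_eq_quadraticChar]
  exact_mod_cast hsum

theorem sum_chiMinus_eq (P : K[X]) (d : ℕ) :
    ∑ F ∈ monics K d, chiMinus P F = (-1) ^ d * ∑ F ∈ monics K d, chi P F := by
  rw [Finset.mul_sum]
  exact Finset.sum_congr rfl fun F hF => by rw [chiMinus, ((mem_monics K).1 hF).2]

theorem sum_chiMinus_eq_zero (hq : Odd (Fintype.card K)) (hP : Irreducible P)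
    (hd : P.natDegree ≤ d) : ∑ F ∈ monics K d, chiMinus P F = 0 := by
  rw [sum_chiMinus_eq, sum_chi_eq_zero hq hP hd, mul_zero]

omit [Fintype K] in
theorem HpmFactor_eq (χ : K[X] → ℂ) (u : ℂ) : HpmFactor χ u = localFactor χ χ u := by
  funext Q
  simp only [HpmFactor, localFactor]
  ring

omit [Fintype K] in
theorem HzeroFactor_eq (P : K[X]) (u : ℂ) :
    HzeroFactor P u = localFactor (chi P) (chiMinus P) u := by
  funext Q
  simp only [HzeroFactor, localFactor, chiMinus, neg_pow u]
  rcases neg_one_pow_eq_or ℂ Q.1.natDegree with h | h <;> rw [h] <;> ring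

theorem meanValue_self (ψ : K[X] →* ℂ) :
    meanValue ψ ψ = LFun ψ (Fintype.card K : ℂ)⁻¹ ^ 2 * Hpm ψ (Fintype.card K : ℂ)⁻¹ := by
  rw [meanValue, Hpm, HpmFactor_eq, LFun, sq]

theorem meanValue_chi_chiMinus (hP : Irreducible P) :
    meanValue (chiHom hP) (chiMinusHom hP) = LFun (chi P) (Fintype.card K : ℂ)⁻¹ *
      LFun (chiMinus P) (Fintype.card K : ℂ)⁻¹ * Hzero P (Fintype.card K : ℂ)⁻¹ := by
  rw [meanValue, Hzero, HzeroFactor_eq]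
  rfl

end Characters

section ParityClasses

variable {K : Type*} [Field K] [Fintype K]

variable (K) in
/-- The triples in `sqfTriples K d` over which `N_{k₁,k₂}(d;P)` is summed: those for which
`deg(f₁f₃) + k₁` and `deg(f₂f₃) + k₂` are even. -/
noncomputable def sqfParityTriples (k₁ k₂ d : ℕ) : Finset (K[X] × K[X] × K[X]) :=
  (sqfTriples K d).filter fun t =>
    Even (k₁ + (t.1.natDegree + t.2.2.natDegree)) ∧
      Even (k₂ + (t.2.1.natDegree + t.2.2.natDegree))

theorem mem_sqfParityTriples {k₁ k₂ d : ℕ} {t : K[X] × K[X] × K[X]} :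
    t ∈ sqfParityTriples K k₁ k₂ d ↔ t ∈ parityTriples K k₁ k₂ d ∧
      Squarefree (t.1 * t.2.1 * t.2.2) := by
  have hparity (k n : ℕ) : Even (k + n) ↔ n ≡ k [MOD 2] := by
    rw [Nat.even_add, Nat.ModEq, Nat.even_iff, Nat.even_iff]
    omega
  simp only [sqfParityTriples, parityTriples, Finset.mem_filter, mem_sqfTriples, hparity,
    Set.mem_ofPred_eq]
  constructor
  · rintro ⟨⟨h1, h2, h3, hd, hs⟩, hpar⟩
    rw [(h1.mul h2).natDegree_mul h3, h1.natDegree_mul h2, h1.natDegree_mul h3,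
      h2.natDegree_mul h3]
    exact ⟨⟨h1, h2, h3, hd, hpar⟩, hs⟩
  · rintro ⟨⟨h1, h2, h3, hd, hpar⟩, hs⟩
    rw [(h1.mul h2).natDegree_mul h3, h1.natDegree_mul h2] at hd
    rw [h1.natDegree_mul h3, h2.natDegree_mul h3] at hpar
    exact ⟨⟨h1, h2, h3, hd, hs⟩, hpar⟩

theorem N_eq_sum_sqfParityTriples (P : K[X]) (k₁ k₂ d : ℕ) :
    N P k₁ k₂ d = ∑ t ∈ sqfParityTriples K k₁ k₂ d, chi P (t.1 * t.2.1) := by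
  classical
  simp only [N, muSq, ite_mul, one_mul, zero_mul, ← Finset.sum_filter]
  refine Finset.sum_congr (Finset.ext fun t => ?_) fun _ _ => rfl
  rw [mem_sqfParityTriples, Finset.mem_filter, Set.Finite.mem_toFinset]

theorem ite_even_eq (n : ℕ) : (if Even n then (1 : ℂ) else 0) = (1 + (-1) ^ n) / 2 := by
  split_ifs with h
  · rw [h.neg_one_pow]
    norm_num
  · rw [(Nat.not_even_iff_odd.1 h).neg_one_pow]
    norm_num

variable {P : K[X]}

theorem N_eq_tripleSum (hP : Irreducible P) (k₁ k₂ d : ℕ) :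
    N P k₁ k₂ d = (tripleSum (chiHom hP) (chiHom hP) d +
      (-1) ^ (k₁ + k₂) * tripleSum (chiMinusHom hP) (chiMinusHom hP) d +
      (-1) ^ d * ((-1) ^ k₁ + (-1) ^ k₂) * tripleSum (chiHom hP) (chiMinusHom hP) d) / 4 := by
  have hsplit : (-1 : ℂ) ^ d * ((-1) ^ k₁ + (-1) ^ k₂) *
      tripleSum (chiHom hP) (chiMinusHom hP) d =
      (-1) ^ d * (-1) ^ k₁ * tripleSum (chiHom hP) (chiMinusHom hP) d +
        (-1) ^ d * (-1) ^ k₂ * tripleSum (chiMinusHom hP) (chiHom hP) d := by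
    rw [tripleSum_comm (chiMinusHom hP)]
    ring
  rw [hsplit, N_eq_sum_sqfParityTriples, sqfParityTriples, Finset.sum_filter]
  simp only [tripleSum, Finset.mul_sum, ← Finset.sum_add_distrib, Finset.sum_div]
  refine Finset.sum_congr rfl fun t ht => ?_
  obtain ⟨-, -, -, rfl, -⟩ := mem_sqfTriples.1 ht
  rw [← mul_boole, ite_and, ← boole_mul]
  simp only [ite_even_eq, ← coe_chiHom hP, map_mul]
  simp only [coe_chiHom, coe_chiMinusHom, chiMinus, pow_add]
  rcases neg_one_pow_eq_or ℂ t.1.natDegree with h1 | h1 <;>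
    rcases neg_one_pow_eq_or ℂ t.2.1.natDegree with h2 | h2 <;>
    rcases neg_one_pow_eq_or ℂ t.2.2.natDegree with h3 | h3 <;>
    rw [h1, h2, h3] <;> ring

theorem Ck_eq_meanValue (hP : Irreducible P) (k₁ k₂ d : ℕ) :
    Ck P k₁ k₂ d = meanValue (chiHom hP) (chiHom hP) +
      (-1) ^ (k₁ + k₂) * meanValue (chiMinusHom hP) (chiMinusHom hP) +
      (-1) ^ d * ((-1) ^ k₁ + (-1) ^ k₂) * meanValue (chiHom hP) (chiMinusHom hP) := by
  rw [meanValue_self, meanValue_self, meanValue_chi_chiMinus, Ck, coe_chiHom, coe_chiMinusHom]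
  ring

theorem isBigO_neg_one_pow_mul {f : ℕ → ℂ} {b : ℕ → ℝ} {l : Filter ℕ} (h : f =O[l] b) (m : ℕ → ℕ) :
    (fun d => (-1) ^ m d * f d) =O[l] b :=
  .of_norm_left (by simpa using h.norm_left)

variable {ε : ℝ}

theorem isBigO_tripleSum_chi_sub (hq : Odd (Fintype.card K)) (hP : Irreducible P) (hε : 0 < ε) :
    (fun d => tripleSum (chiHom hP) (chiHom hP) d -
      meanValue (chiHom hP) (chiHom hP) * Fintype.card K ^ d) =O[⊤]
        errorScale (Fintype.card K) ε := by
  have hv : ∀ᶠ d in atTop, ∑ F ∈ monics K d, chiHom hP F = 0 :=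
    eventually_atTop.2 ⟨P.natDegree, fun d hd => sum_chi_eq_zero hq hP hd⟩
  exact isBigO_tripleSum_sub (norm_chi_le P) (norm_chi_le P) hv hv hε

theorem isBigO_N_sub (hq : Odd (Fintype.card K)) (hP : Irreducible P) (k₁ k₂ : ℕ) (hε : 0 < ε) :
    (fun d => N P k₁ k₂ d - Ck P k₁ k₂ d / 4 * Fintype.card K ^ d) =O[⊤]
      errorScale (Fintype.card K) ε := by
  have hv : ∀ᶠ d in atTop, ∑ F ∈ monics K d, chiHom hP F = 0 :=
    eventually_atTop.2 ⟨P.natDegree, fun d hd => sum_chi_eq_zero hq hP hd⟩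
  have hv' : ∀ᶠ d in atTop, ∑ F ∈ monics K d, chiMinusHom hP F = 0 :=
    eventually_atTop.2 ⟨P.natDegree, fun d hd => sum_chiMinus_eq_zero hq hP hd⟩
  have hpp := isBigO_tripleSum_sub (norm_chi_le P) (norm_chi_le P) hv hv hε
  have hmm := isBigO_tripleSum_sub (norm_chiMinus_le P) (norm_chiMinus_le P) hv' hv' hε
  have hpm := isBigO_tripleSum_sub (norm_chi_le P) (norm_chiMinus_le P) hv hv' hε
  refine ((((hpp.add (isBigO_neg_one_pow_mul hmm fun _ => k₁ + k₂)).add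
    (isBigO_neg_one_pow_mul hpm fun d => d + k₁)).add
    (isBigO_neg_one_pow_mul hpm fun d => d + k₂)).const_mul_left 4⁻¹).congr_left fun d => ?_
  rw [N_eq_tripleSum hP, Ck_eq_meanValue hP]
  ring

end ParityClasses

section AxisTriples

theorem multiset_eq_single_iff {n a b c : ℕ} (hn : 0 < n) (h : a + b + c = n) :
    ({a, b, c} : Multiset ℕ) = {n, 0, 0} ↔
      b = 0 ∧ c = 0 ∨ a = 0 ∧ c = 0 ∨ a = 0 ∧ b = 0 := by
  constructor
  · intro he
    have hmem : n ∈ ({a, b, c} : Multiset ℕ) := he ▸ Multiset.mem_cons_self n _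
    simp only [Multiset.insert_eq_cons, Multiset.mem_cons, Multiset.mem_singleton] at hmem
    omega
  · rintro (⟨rfl, rfl⟩ | ⟨rfl, rfl⟩ | ⟨rfl, rfl⟩) <;> obtain rfl : _ = n := h
    · rfl
    · simpa [Multiset.insert_eq_cons] using Multiset.cons_swap 0 b {0}
    · simpa [Multiset.insert_eq_cons, ← Multiset.cons_zero] using
        (congrArg (0 ::ₘ ·) (Multiset.cons_swap 0 c 0)).trans (Multiset.cons_swap 0 c {0})

variable {K : Type*} [Field K] [Fintype K]

variable (K) in
/-- The triples in `sqfTriples K n` with the multiset of degrees `{n, 0, 0}`, which are excluded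
from `Fg`. -/
noncomputable def axisTriples (n : ℕ) : Finset (K[X] × K[X] × K[X]) :=
  (sqfTriples K n).filter fun t =>
    ({t.1.natDegree, t.2.1.natDegree, t.2.2.natDegree} : Multiset ℕ) = {n, 0, 0}

open Classical in
theorem axisTriples_eq {n : ℕ} (hn : 0 < n) :
    axisTriples K n = (sqfMonics K n).image (fun F => (F, 1, 1)) ∪
      ((sqfMonics K n).image (fun F => (1, F, 1)) ∪
        (sqfMonics K n).image fun F => (1, 1, F)) := by
  ext ⟨f₁, f₂, f₃⟩
  simp only [axisTriples, Finset.mem_filter, Finset.mem_union, Finset.mem_image, mem_sqfTriples,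
    mem_sqfMonics, Prod.mk.injEq]
  constructor
  · rintro ⟨⟨h₁, h₂, h₃, hd, hs⟩, hdeg⟩
    rw [multiset_eq_single_iff hn hd, h₁.natDegree_eq_zero, h₂.natDegree_eq_zero,
      h₃.natDegree_eq_zero] at hdeg
    rcases hdeg with ⟨rfl, rfl⟩ | ⟨rfl, rfl⟩ | ⟨rfl, rfl⟩
    · exact .inl ⟨f₁, ⟨h₁, by simpa using hd, by simpa using hs⟩, rfl, rfl, rfl⟩
    · exact .inr (.inl ⟨f₂, ⟨h₂, by simpa using hd, by simpa using hs⟩, rfl, rfl, rfl⟩)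
    · exact .inr (.inr ⟨f₃, ⟨h₃, by simpa using hd, by simpa using hs⟩, rfl, rfl, rfl⟩)
  · rintro (⟨F, ⟨hF, hd, hs⟩, rfl, rfl, rfl⟩ | ⟨F, ⟨hF, hd, hs⟩, rfl, rfl, rfl⟩ |
      ⟨F, ⟨hF, hd, hs⟩, rfl, rfl, rfl⟩) <;>
      refine ⟨⟨?_, ?_, ?_, ?_, ?_⟩, (multiset_eq_single_iff hn ?_).2 ?_⟩ <;> simp [hF, hd, hs]

theorem sum_axisTriples {A : Type*} [AddCommMonoid A] (f : K[X] × K[X] × K[X] → A) {n : ℕ}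
    (hn : 0 < n) :
    ∑ t ∈ axisTriples K n, f t =
      ∑ F ∈ sqfMonics K n, (f (F, 1, 1) + (f (1, F, 1) + f (1, 1, F))) := by
  classical
  have hne {F : K[X]} (hF : F ∈ sqfMonics K n) : F ≠ 1 := by
    rintro rfl
    exact hn.ne (natDegree_one.symm.trans (mem_sqfMonics.1 hF).2.1)
  rw [axisTriples_eq hn, Finset.sum_union, Finset.sum_union, Finset.sum_image, Finset.sum_image,
    Finset.sum_image, Finset.sum_add_distrib, Finset.sum_add_distrib]
  all_goals simp +contextual [Set.InjOn, Finset.disjoint_left, hne, eq_comm]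

theorem sum_chi_axisTriples {P : K[X]} (hP : Irreducible P) {n : ℕ} (hn : 0 < n) :
    ∑ t ∈ axisTriples K n, chi P (t.1 * t.2.1) =
      2 * sqfreeCharSum P n + (sqfMonics K n).card := by
  have hone : chi P 1 = 1 := by rw [← coe_chiHom hP, map_one]
  simp only [sum_axisTriples _ hn, mul_one, one_mul, hone, Finset.sum_add_distrib,
    Finset.sum_const, nsmul_one, sqfreeCharSum, sum_muSq_mul]
  ring

theorem axisTriples_subset_sqfParityTriples {n : ℕ} (hn : 0 < n) (h : Even n) :
    axisTriples K n ⊆ sqfParityTriples K 0 0 n := by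
  intro t ht
  rw [axisTriples, Finset.mem_filter] at ht
  obtain ⟨ht, hdeg⟩ := ht
  have hd := (mem_sqfTriples.1 ht).2.2.2.1
  rw [multiset_eq_single_iff hn hd] at hdeg
  rw [sqfParityTriples, Finset.mem_filter, Nat.even_iff, Nat.even_iff]
  rw [Nat.even_iff] at h
  exact ⟨ht, by omega, by omega⟩

theorem disjoint_sqfParityTriples_axisTriples {n : ℕ} (h : Odd n) :
    Disjoint (sqfParityTriples K 0 0 n) (axisTriples K n) := by
  refine Finset.disjoint_left.2 fun t hpar ht => ?_
  rw [axisTriples, Finset.mem_filter] at ht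
  have hd := (mem_sqfTriples.1 ht.1).2.2.2.1
  have hdeg := (multiset_eq_single_iff h.pos hd).1 ht.2
  rw [sqfParityTriples, Finset.mem_filter, Nat.even_iff, Nat.even_iff] at hpar
  rw [Nat.odd_iff] at h
  omega

end AxisTriples

section GenusSum

variable {K : Type*} [Field K] [Fintype K]

omit [Fintype K] in
theorem mem_Fg {g : ℕ} {t : K[X] × K[X] × K[X]} :
    t ∈ Fg K g ↔ t.1.Monic ∧ t.2.1.Monic ∧ t.2.2.Monic ∧ Squarefree (t.1 * t.2.1 * t.2.2) ∧
      genusL t.1.natDegree t.2.1.natDegree t.2.2.natDegree = g + 3 ∧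
      ({t.1.natDegree, t.2.1.natDegree, t.2.2.natDegree} : Multiset ℕ) ≠ {g + 3, 0, 0} ∧
      ({t.1.natDegree, t.2.1.natDegree, t.2.2.natDegree} : Multiset ℕ) ≠ {g + 2, 0, 0} := by
  simp only [Fg, FgHat, Set.mem_ofPred_eq, squarefree_mul_iff, isRelPrime_iff_isCoprime,
    IsCoprime.mul_left_iff]
  tauto

open Classical in
theorem toFinset_Fg (g : ℕ) :
    (Fg_finite K g).toFinset =
      (sqfParityTriples K 0 0 (g + 3) \ axisTriples K (g + 3)) ∪
        ((sqfTriples K (g + 2) \ sqfParityTriples K 0 0 (g + 2)) \ axisTriples K (g + 2)) := by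
  ext t
  have hsum {n : ℕ}
      (h : ({t.1.natDegree, t.2.1.natDegree, t.2.2.natDegree} : Multiset ℕ) = {n, 0, 0}) :
      t.1.natDegree + t.2.1.natDegree + t.2.2.natDegree = n := by
    simpa [add_assoc] using congrArg Multiset.sum h
  have hsum₂ := @hsum (g + 2)
  have hsum₃ := @hsum (g + 3)
  simp only [Set.Finite.mem_toFinset, mem_Fg, genusL, Finset.mem_union, Finset.mem_sdiff,
    sqfParityTriples, axisTriples, Finset.mem_filter, mem_sqfTriples, zero_add, Nat.even_iff]
  split_ifs <;> grind

theorem sumFg_eq (P : K[X]) (g : ℕ) :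
    sumFg P g = N P 0 0 (g + 3) +
      (∑ t ∈ sqfTriples K (g + 2), chi P (t.1 * t.2.1) - N P 0 0 (g + 2)) -
      (1 - eta g) * (∑ t ∈ axisTriples K (g + 2), chi P (t.1 * t.2.1) +
        ∑ t ∈ axisTriples K (g + 3), chi P (t.1 * t.2.1)) := by
  classical
  have hpar (n : ℕ) : sqfParityTriples K 0 0 n ⊆ sqfTriples K n := Finset.filter_subset _ _
  have hdisj : Disjoint (sqfParityTriples K 0 0 (g + 3) \ axisTriples K (g + 3))
      ((sqfTriples K (g + 2) \ sqfParityTriples K 0 0 (g + 2)) \ axisTriples K (g + 2)) := by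
    refine Finset.disjoint_left.2 fun t h₃ h₂ => ?_
    have hd₃ := (mem_sqfTriples.1 (hpar _ (Finset.mem_sdiff.1 h₃).1)).2.2.2.1
    have hd₂ := (mem_sqfTriples.1 (Finset.mem_sdiff.1 (Finset.mem_sdiff.1 h₂).1).1).2.2.2.1
    omega
  rw [sumFg, toFinset_Fg, Finset.sum_union hdisj, N_eq_sum_sqfParityTriples,
    N_eq_sum_sqfParityTriples, ← Finset.sum_sdiff_eq_sub (hpar _)]
  rcases Nat.even_or_odd g with hg | hg
  · have h₃ := disjoint_sqfParityTriples_axisTriples (K := K) (n := g + 3) (by grind)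
    have h₂ := (axisTriples_subset_sqfParityTriples (K := K) (n := g + 2) (by omega) (by grind))
    rw [Finset.sdiff_eq_self_of_disjoint h₃, Finset.sdiff_eq_self_of_disjoint
      (Finset.disjoint_sdiff.symm.mono_right h₂), eta, if_pos hg]
    ring
  · have h₃ := axisTriples_subset_sqfParityTriples (K := K) (n := g + 3) (by omega) (by grind)
    have h₂ : axisTriples K (g + 2) ⊆ sqfTriples K (g + 2) \ sqfParityTriples K 0 0 (g + 2) :=
      Finset.subset_sdiff.2
        ⟨Finset.filter_subset _ _, (disjoint_sqfParityTriples_axisTriples (by grind)).symm⟩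
    rw [Finset.sum_sdiff_eq_sub h₃, Finset.sum_sdiff_eq_sub h₂, eta,
      if_neg (Nat.not_even_iff_odd.2 hg)]
    ring

theorem C_eq_meanValue {P : K[X]} (hP : Irreducible P) (g : ℕ) :
    C P g = (Fintype.card K + 3) / Fintype.card K * meanValue (chiHom hP) (chiHom hP) +
      (Fintype.card K - 1) / Fintype.card K * meanValue (chiMinusHom hP) (chiMinusHom hP) -
      2 * (-1) ^ g * ((Fintype.card K + 1) / Fintype.card K) *
        meanValue (chiHom hP) (chiMinusHom hP) := by
  rw [meanValue_self, meanValue_self, meanValue_chi_chiMinus, C, coe_chiHom, coe_chiMinusHom]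
  ring

theorem C_mul_pow {P : K[X]} (hP : Irreducible P) (g : ℕ) :
    C P g / 4 * (Fintype.card K : ℂ) ^ (g + 3) =
      Ck P 0 0 (g + 3) / 4 * (Fintype.card K : ℂ) ^ (g + 3) +
        (meanValue (chiHom hP) (chiHom hP) * (Fintype.card K : ℂ) ^ (g + 2) -
          Ck P 0 0 (g + 2) / 4 * (Fintype.card K : ℂ) ^ (g + 2)) := by
  have hq : (Fintype.card K : ℂ) ≠ 0 := Nat.cast_ne_zero.2 Fintype.card_ne_zero
  rw [C_eq_meanValue hP, Ck_eq_meanValue hP, Ck_eq_meanValue hP]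
  field_simp
  ring

theorem sum_chi_axisTriples_add {P : K[X]} (hP : Irreducible P) (g : ℕ) :
    ∑ t ∈ axisTriples K (g + 2), chi P (t.1 * t.2.1) +
        ∑ t ∈ axisTriples K (g + 3), chi P (t.1 * t.2.1) =
      2 * (sqfreeCharSum P (g + 2) + sqfreeCharSum P (g + 3)) +
        ((Fintype.card K : ℂ) + 1) / Fintype.card K *
          ((Fintype.card K : ℂ) ^ (g + 3) / zetaQ K 2) := by
  have hq : (Fintype.card K : ℂ) ≠ 0 := Nat.cast_ne_zero.2 Fintype.card_ne_zero
  rw [sum_chi_axisTriples hP (by omega), sum_chi_axisTriples hP (by omega),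
    card_sqfMonics (by omega), card_sqfMonics (by omega), div_eq_mul_inv _ (zetaQ K 2),
    div_eq_mul_inv _ (zetaQ K 2)]
  field_simp
  ring

end GenusSum

section ErrorTerm

variable {q ε : ℝ}

theorem isBigO_errorScale_comp_add (hq : 0 < q) {f : ℕ → ℂ} (h : f =O[⊤] errorScale q ε) (k : ℕ) :
    (fun d => f (d + k)) =O[⊤] errorScale q ε := by
  have hscale : (fun d => errorScale q ε (d + k)) =
      fun d => q ^ ((1 / 2 + ε) * k) * errorScale q ε d := by
    funext d
    rw [errorScale, errorScale, ← Real.rpow_add hq]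
    push_cast
    ring_nf
  have hshift : (fun d => f (d + k)) =O[⊤] fun d => errorScale q ε (d + k) :=
    h.comp_tendsto tendsto_top
  rw [hscale] at hshift
  exact hshift.trans (isBigO_const_mul_self _ _ _)

theorem exists_norm_le_mul_rpow (hq : 0 ≤ q) {f : ℕ → ℂ} (h : f =O[⊤] errorScale q ε) :
    ∃ A : ℝ, ∀ d : ℕ, ‖f d‖ ≤ A * q ^ ((1 / 2 + ε) * (d : ℝ)) := by
  obtain ⟨A, hA⟩ := isBigO_top.1 h
  exact ⟨A, fun d => (hA d).trans_eq
    (congrArg (A * ·) (Real.norm_of_nonneg (Real.rpow_nonneg hq _)))⟩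

end ErrorTerm

section GenusAsymptotic

variable {K : Type*} [Field K] [Fintype K]

theorem isBigO_sumFg_sub (hq : Odd (Fintype.card K)) {P : K[X]} (hP : Irreducible P) {ε : ℝ}
    (hε : 0 < ε) :
    (fun g => sumFg P g - (C P g / 4 * (Fintype.card K : ℂ) ^ (g + 3) - (1 - eta g) *
      (2 * (sqfreeCharSum P (g + 2) + sqfreeCharSum P (g + 3)) +
        ((Fintype.card K : ℂ) + 1) / (Fintype.card K : ℂ) *
          ((Fintype.card K : ℂ) ^ (g + 3) / zetaQ K 2)))) =O[⊤]
      errorScale (Fintype.card K) ε := by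
  have heven := isBigO_N_sub hq hP 0 0 hε
  have hall := isBigO_tripleSum_chi_sub hq hP hε
  have hshift {f : ℕ → ℂ} := isBigO_errorScale_comp_add (ε := ε) (f := f) (card_pos_real K)
  refine ((hshift heven 3).add ((hshift hall 2).sub (hshift heven 2))).congr_left fun g => ?_
  have htriples : ∑ t ∈ sqfTriples K (g + 2), chi P (t.1 * t.2.1) =
      tripleSum (chiHom hP) (chiHom hP) (g + 2) := by
    simp only [tripleSum, ← coe_chiHom hP, map_mul]
  rw [sumFg_eq, sum_chi_axisTriples_add hP, C_mul_pow hP, htriples]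
  ring

end GenusAsymptotic

end Biquad

theorem proposition6p2 {K : Type*} [Field K] [Fintype K] (hq : Odd (Fintype.card K))
    (P : K[X]) (hP : Irreducible P) :
    -- `L(u, χ_P^±)` are polynomials in `u` of degree less than `deg P`
    (∀ d : ℕ, P.natDegree ≤ d →
      ∑ F ∈ Biquad.monics K d, Biquad.chi P F = 0 ∧
      ∑ F ∈ Biquad.monics K d, Biquad.chiMinus P F = 0) ∧
    -- the products `H_{P,+}(u)`, `H_{P,-}(u)`, `H_{P,0}(u)` converge for `|u| < q^{-1/2}`
    (∀ u : ℂ, ‖u‖ < (Fintype.card K : ℝ) ^ (-(1 / 2) : ℝ) →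
      Multipliable (Biquad.HpmFactor (Biquad.chi P) u) ∧
      Multipliable (Biquad.HpmFactor (Biquad.chiMinus P) u) ∧
      Multipliable (Biquad.HzeroFactor P u)) ∧
    -- the asymptotic formula for `N_{k₁,k₂}(d;P)`
    (∀ k₁ k₂ : Fin 2, ∀ ε : ℝ, 0 < ε → ∃ A : ℝ, ∀ d : ℕ,
      ‖Biquad.N P k₁ k₂ d - Biquad.Ck P k₁ k₂ d / 4 * (Fintype.card K : ℂ) ^ d‖ ≤
        A * (Fintype.card K : ℝ) ^ ((1 / 2 + ε) * (d : ℝ))) ∧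
    -- the asymptotic formula for the sum over `F_g`
    (∀ ε : ℝ, 0 < ε → ∃ A : ℝ, ∀ g : ℕ,
      ‖Biquad.sumFg P g -
          (Biquad.C P g / 4 * (Fintype.card K : ℂ) ^ (g + 3) -
            (1 - Biquad.eta g) *
              (2 * (Biquad.sqfreeCharSum P (g + 2) + Biquad.sqfreeCharSum P (g + 3)) +
                ((Fintype.card K : ℂ) + 1) / (Fintype.card K : ℂ) *
                  ((Fintype.card K : ℂ) ^ (g + 3) / Biquad.zetaQ K 2)))‖ ≤
        A * (Fintype.card K : ℝ) ^ ((1 / 2 + ε) * (g : ℝ))) := by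
  have hq0 := (Biquad.card_pos_real K).le
  have h₁ := Biquad.norm_chi_le P
  have h₂ := Biquad.norm_chiMinus_le P
  refine ⟨fun d hd => ⟨Biquad.sum_chi_eq_zero hq hP hd, Biquad.sum_chiMinus_eq_zero hq hP hd⟩,
    fun u hu => ?_,
    fun k₁ k₂ ε hε => Biquad.exists_norm_le_mul_rpow hq0 (Biquad.isBigO_N_sub hq hP k₁ k₂ hε),
    fun ε hε => Biquad.exists_norm_le_mul_rpow hq0 (Biquad.isBigO_sumFg_sub hq hP hε)⟩
  rw [Biquad.HpmFactor_eq, Biquad.HpmFactor_eq, Biquad.HzeroFactor_eq]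
  exact ⟨Biquad.multipliable_localFactor h₁ h₁ hu, Biquad.multipliable_localFactor h₂ h₂ hu,
    Biquad.multipliable_localFactor h₁ h₂ hu⟩
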